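/- Notation. An edge-weighted graph $G$ on a finite vertex set $V$ is a simple graph with a weight $w_G(uv)\in[0,1]$ on each edge; put $w_G(uv)=0$ if $uv$ is not an edge. For $S,T\subseteq V$ let $e_G(S,T)=\sum_{u\in S,\,v\in T}w_G(uv)$, and for two edge-weighted graphs $G,G'$ on the same vertex set $V$ let $d(G,G')=\max_{S,T\subseteq V}|e_G(S,T)-e_{G'}(S,T)|$ be their cut-distance. A straight-line drawing of $G$ places the vertices at distinct points of the plane, no three collinear, and represents the edges by segments so that no point lies in the interior of three distinct edges; two edges cross if their interiors have a common point. The rectilinear crossing number of the edge-weighted graph $G$ is $\overline{\mathrm{cr}}(G)=\min_{\mathcal D}\sum_{\{e,f\}}w_G(e)\,w_G(f)$, where the minimum is over all straight-line drawings $\mathcal D$ of $G$ and the sum is over all unordered pairs of edges that cross in $\mathcal D$. A family of disjoint finite planar point sets $V_1,\dots,V_k$ with union in general position (no three points collinear) has same-type transversals if for all indices $a<b<c$ the orientation of the triple $(v_a,v_b,v_c)$ is the same for all choices of $v_i\in V_i$, $1\le i\le k$. Call a real number $C$ a same-type partition constant if for each $0<\delta<1/2$ every finite set $P\subset\mathbb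 R^2$ in general position has a partition $P=V_1\cup\dots\cup V_K$ into disjoint (possibly empty) parts whose sizes pairwise differ by at most one, with $1/\delta<K<\delta^{-C}$, such that all but at most $\delta\binom K4$ of the quadruples of parts $\{V_{i_1},V_{i_2},V_{i_3},V_{i_4}\}$ have same-type transversals. Lemma. Same-type partition constants exist. Let $C$ be any same-type partition constant, let $\varepsilon\in(0,1/2)$, and let $G$ and $G'$ be two $n$-vertex edge-weighted graphs on the same vertex set. If $d(G,G')<\varepsilon n^2$, then $$|\overline{\mathrm{cr}}(G)-\overline{\mathrm{cr}}(G')|\le\varepsilon^{1/(4C)}n^4 .$$ -/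

import Mathlib

/-- The Euclidean plane. -/
abbrev Plane : Type := EuclideanSpace ℝ (Fin 2)

/-! ### Edge-weighted graphs and the cut-distance -/

/-- An edge-weighted graph on `V`: a simple graph whose edges carry weights in `[0, 1]`; by
convention the weight of a non-edge (in particular of a loop) is `0`. -/
structure EdgeWeightedGraph (V : Type*) where
  graph : SimpleGraph V
  weight : Sym2 V → ℝ
  weight_mem : ∀ e ∈ graph.edgeSet, weight e ∈ Set.Icc (0 : ℝ) 1
  weight_eq_zero : ∀ e, e ∉ graph.edgeSet → weight e = 0

namespace EdgeWeightedGraph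

/-- `e_G(S, T) = ∑_{u ∈ S, v ∈ T} w_G(uv)`. -/
def cutWeight {V : Type*} (G : EdgeWeightedGraph V) (S T : Finset V) : ℝ :=
  ∑ u ∈ S, ∑ v ∈ T, G.weight s(u, v)

/-- The cut-distance `d(G, G') = max_{S, T ⊆ V} |e_G(S, T) - e_{G'}(S, T)|`. -/
noncomputable def cutDistance {V : Type*} [Fintype V] (G G' : EdgeWeightedGraph V) : ℝ :=
  (Finset.univ : Finset (Finset V × Finset V)).sup' Finset.univ_nonempty
    (fun p => |G.cutWeight p.1 p.2 - G'.cutWeight p.1 p.2|)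

end EdgeWeightedGraph

/-! ### Straight-line drawings and the rectilinear crossing number -/

/-- The interior of the segment that represents the pair `e` when the vertices are placed
by `f`. -/
def edgeInterior {V : Type*} (f : V → Plane) (e : Sym2 V) : Set Plane :=
  Sym2.lift ⟨fun u v => openSegment ℝ (f u) (f v), fun u v => openSegment_symm ℝ (f u) (f v)⟩ e

/-- The placement `f` of the vertices is a straight-line drawing of `G`: the vertices are distinct
points, no three of them are collinear, and no point lies in the interior of three distinct
edges. -/
structure IsStraightLineDrawing {V : Type*} (G : SimpleGraph V) (f : V → Plane) : Prop where
  injective : Function.Injective f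
  not_collinear : ∀ u v w : V, u ≠ v → u ≠ w → v ≠ w → ¬ Collinear ℝ {f u, f v, f w}
  not_concurrent : ∀ e₁ ∈ G.edgeSet, ∀ e₂ ∈ G.edgeSet, ∀ e₃ ∈ G.edgeSet,
    e₁ ≠ e₂ → e₁ ≠ e₃ → e₂ ≠ e₃ →
      edgeInterior f e₁ ∩ edgeInterior f e₂ ∩ edgeInterior f e₃ = ∅

open Classical in
/-- The set of unordered pairs `X = {e₁, e₂}` of distinct edges of `G` whose interiors have a point
in common when the vertices are placed by `f`. -/
noncomputable def crossingPairs {V : Type*} [Fintype V] (G : SimpleGraph V) (f : V → Plane) :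
    Finset (Finset (Sym2 V)) :=
  Finset.univ.filter fun X =>
    X.card = 2 ∧ (X : Set (Sym2 V)) ⊆ G.edgeSet ∧ (⋂ e ∈ X, edgeInterior f e).Nonempty

namespace EdgeWeightedGraph

/-- The weighted number of crossings of `G` in the drawing `f`: the sum of `w(e₁) * w(e₂)` over the
unordered pairs `{e₁, e₂}` of crossing edges. -/
noncomputable def weightedCrossings {V : Type*} [Fintype V] (G : EdgeWeightedGraph V)
    (f : V → Plane) : ℝ :=
  ∑ X ∈ crossingPairs G.graph f, ∏ e ∈ X, G.weight e

/-- The rectilinear crossing number of an edge-weighted graph. The set below is finite (there are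
finitely many sets of crossing pairs) and nonempty (a generic placement of the vertices is a
drawing), so its infimum is its minimum. -/
noncomputable def rectilinearCrossingNumber {V : Type*} [Fintype V]
    (G : EdgeWeightedGraph V) : ℝ :=
  sInf {x : ℝ | ∃ f : V → Plane, IsStraightLineDrawing G.graph f ∧ x = G.weightedCrossings f}

end EdgeWeightedGraph

/-! ### Order types and same-type transversals -/

/-- The orientation of a triple of points. -/
noncomputable def orientationSign (p q r : Plane) : SignType :=
  SignType.sign (Matrix.det !![1, 1, 1; p 0, q 0, r 0; p 1, q 1, r 1])

/-- A finite point set is in general position if no three of its points are collinear. -/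
def InGeneralPosition (P : Finset Plane) : Prop :=
  ∀ p ∈ P, ∀ q ∈ P, ∀ r ∈ P, p ≠ q → p ≠ r → q ≠ r → ¬ Collinear ℝ {p, q, r}

/-- The parts `A i`, `i ∈ s`, have same-type transversals: any two transversals `f`, `g` (choices of
one point from each of these parts) have the same order type. -/
def HasSameTypeTransversals {K : ℕ} (A : Fin K → Finset Plane) (s : Finset (Fin K)) : Prop :=
  ∀ f g : Fin K → Plane, (∀ i ∈ s, f i ∈ A i) → (∀ i ∈ s, g i ∈ A i) →
    ∀ i ∈ s, ∀ j ∈ s, ∀ k ∈ s, i < j → j < k →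
      orientationSign (f i) (f j) (f k) = orientationSign (g i) (g j) (g k)

open Classical in
/-- The quadruples of parts that do not have same-type transversals. -/
noncomputable def badQuadruples {K : ℕ} (A : Fin K → Finset Plane) : Finset (Finset (Fin K)) :=
  (Finset.powersetCard 4 Finset.univ).filter fun s => ¬ HasSameTypeTransversals A s

/-- `A` is an equitable partition of `P`: the parts are pairwise disjoint with union `P`, and the
sizes of any two parts differ by at most one (if `P` has fewer points than there are parts, some
parts are empty). -/
structure IsEquitablePartition (P : Finset Plane) {K : ℕ} (A : Fin K → Finset Plane) : Prop where
  disjoint : ∀ i j, i ≠ j → Disjoint (A i) (A j)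
  mem_iff : ∀ p, p ∈ P ↔ ∃ i, p ∈ A i
  card_le : ∀ i j, (A i).card ≤ (A j).card + 1

/-- `C` is an admissible constant in the same-type partition theorem: for `0 < ε < 1/2`, every
finite planar point set in general position has an equitable partition into `K` parts, with
`1/ε < K < ε ^ (-C)`, such that all but at most `ε * (K choose 4)` quadruples of parts have
same-type transversals. -/
def IsSameTypePartitionConstant (C : ℝ) : Prop :=
  ∀ ε : ℝ, 0 < ε → ε < 1 / 2 → ∀ P : Finset Plane, InGeneralPosition P →
    ∃ (K : ℕ) (A : Fin K → Finset Plane), 1 / ε < (K : ℝ) ∧ (K : ℝ) < ε ^ (-C) ∧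
      IsEquitablePartition P A ∧ ((badQuadruples A).card : ℝ) ≤ ε * (K.choose 4 : ℝ)

/-! Stability. In a placement with no three points collinear, whether two vertex pairs cross is
decided by four orientations (`openSegment_inter_nonempty_iff`). A generic placement can be
perturbed into a drawing without changing orientations (`IsGeneric.exists_drawing`), so it suffices
to compare the crossing sums of `G` and `G'` for each generic placement separately. Cut the placed
points into K parts. Over four distinct parts with same-type transversals the crossing pattern is
constant, so these quadruples contribute a sum of products of two cut weights between parts. Passing
from `G` to `G'` moves each cut weight by at most the cut-distance d, and the total change is at
most 2dK²n² (`abs_sum_mul_sub_mul_le`). The other quadruples have two vertices in a common part,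
about n⁴/K of them up to a constant, or lie over a bad quadruple of parts, about δn⁴ of them. With δ
a constant multiple of ε^(1/(4C)), the bound K < δ^(-C) makes εK² of order at most δ².

Existence of partition constants. A vertical halving line and a ham-sandwich cut divide a point set
into four quadrants of nearly equal size, and every line misses one of them. Iterating k times gives
4^k pairwise separated classes such that the classes met by any one line hold only about (3/4)^k of
the points (`exists_labelling_stabs_le`). If three pairwise separated classes have transversals of
both orientations, some line meets all three hulls, and it can be moved until it is an inner tangent
of two of them while still meeting the third (`exists_innerTangent_of_stabs`). Two classes have at
most one inner tangent line of each sign (`IsInnerTangent.lineMeets_of`), so for each pair of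
classes only a small fraction of the points lies in a third class that forms a bad triple with them.
An equitable refinement of the classes transfers this count to parts of nearly equal size
(`card_badTriples_mul_le`), and each bad quadruple contains a bad triple. -/

/-! ### The orientation determinant -/

/-- Twice the signed area of the triangle `p q r`. -/
noncomputable def det3 (p q r : Plane) : ℝ :=
  (q 0 - p 0) * (r 1 - p 1) - (q 1 - p 1) * (r 0 - p 0)

theorem orientationSign_eq (p q r : Plane) : orientationSign p q r = SignType.sign (det3 p q r) := by
  unfold orientationSign det3
  congr 1
  simp [Matrix.det_fin_three]
  ring

theorem det3_rotate (p q r : Plane) : det3 q r p = det3 p q r := by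
  unfold det3; ring

theorem det3_swap (p q r : Plane) : det3 p r q = -det3 p q r := by
  unfold det3; ring

theorem det3_swap_left (p q r : Plane) : det3 q p r = -det3 p q r := by
  unfold det3; ring

/-- The signed areas of the four triangles of a quadruple satisfy one linear relation. It links the
two side tests for crossing segments and forces uniqueness of inner tangents. -/
theorem det3_four (a b c d : Plane) : det3 a b c - det3 a b d + det3 a c d - det3 b c d = 0 := by
  unfold det3; ring

theorem det3_combination (a b c d : Plane) {s t : ℝ} (h : s + t = 1) :
    det3 a b (s • c + t • d) = s * det3 a b c + t * det3 a b d := by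
  obtain rfl : t = 1 - s := by linarith
  simp [det3]; ring

theorem det3_of_mem_openSegment {a b x : Plane} (hx : x ∈ openSegment ℝ a b) : det3 a b x = 0 := by
  obtain ⟨s, t, -, -, h, rfl⟩ := hx
  rw [det3_combination _ _ _ _ h]
  simp [det3]; ring_nf; simp

theorem plane_ext {p q : Plane} (h0 : p 0 = q 0) (h1 : p 1 = q 1) : p = q := by
  ext i; fin_cases i <;> assumption

theorem det3_eq_zero_of_collinear {p q r : Plane} (h : Collinear ℝ {p, q, r}) : det3 p q r = 0 := by
  obtain ⟨v, hv⟩ := (collinear_iff_of_mem (p₀ := p) (by simp)).1 h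
  obtain ⟨s, rfl⟩ := hv q (by simp)
  obtain ⟨t, rfl⟩ := hv r (by simp)
  simp [det3]; ring

theorem collinear_of_det3_eq_zero {p q r : Plane} (h : det3 p q r = 0) : Collinear ℝ {p, q, r} := by
  by_cases hpq : p = q
  · subst hpq; simpa using collinear_pair ℝ p r
  refine (collinear_iff_of_mem (p₀ := p) (by simp)).2 ⟨q - p, ?_⟩
  intro x hx
  simp only [Set.mem_insert_iff, Set.mem_singleton_iff] at hx
  rcases hx with rfl | rfl | rfl
  · exact ⟨0, by simp⟩
  · exact ⟨1, by simp⟩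
  unfold det3 at h
  by_cases h0 : q 0 - p 0 = 0
  · have h1 : q 1 - p 1 ≠ 0 := fun h1 => hpq (plane_ext (by linarith) (by linarith))
    refine ⟨(x 1 - p 1) / (q 1 - p 1), plane_ext ?_ ?_⟩
    · have : x 0 - p 0 = 0 := by
        rw [h0] at h
        have := mul_eq_zero.1 (show (q 1 - p 1) * (x 0 - p 0) = 0 by linarith)
        tauto
      simp [h0]; linarith
    · simp; field_simp; ring
  · refine ⟨(x 0 - p 0) / (q 0 - p 0), plane_ext ?_ ?_⟩
    · simp; field_simp; ring
    · simp; field_simp; linarith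

theorem sign_ne_sign_iff {x y : ℝ} (hx : x ≠ 0) (hy : y ≠ 0) :
    SignType.sign x ≠ SignType.sign y ↔ x * y < 0 := by
  rcases hx.lt_or_gt with hx | hx <;> rcases hy.lt_or_gt with hy | hy
  · simp [sign_neg hx, sign_neg hy, (mul_pos_of_neg_of_neg hx hy).le]
  · simp [sign_neg hx, sign_pos hy, mul_neg_of_neg_of_pos hx hy]
  · simp [sign_pos hx, sign_neg hy, mul_neg_of_pos_of_neg hx hy]
  · simp [sign_pos hx, sign_pos hy, (mul_pos hx hy).le]

theorem mul_neg_of_combination {s t x y : ℝ} (hs : 0 < s) (ht : 0 < t) (hx : x ≠ 0)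
    (h : s * x + t * y = 0) : x * y < 0 := by
  have : t * (x * y) = -(s * x ^ 2) := by linear_combination x * h
  have h2 : 0 < s * x ^ 2 := by positivity
  nlinarith

/-- A common point makes a positive combination of the two determinants on each line vanish, so they
have opposite signs. Conversely, weights proportional to the determinants give a point on each
segment, and `det3_four` shows that these two points coincide. -/
theorem openSegment_inter_nonempty_iff {a b c d : Plane} (hc : det3 a b c ≠ 0)
    (hd : det3 a b d ≠ 0) (ha : det3 c d a ≠ 0) (hb : det3 c d b ≠ 0) :
    (openSegment ℝ a b ∩ openSegment ℝ c d).Nonempty ↔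
      orientationSign a b c ≠ orientationSign a b d ∧
        orientationSign c d a ≠ orientationSign c d b := by
  simp only [orientationSign_eq]
  rw [sign_ne_sign_iff hc hd, sign_ne_sign_iff ha hb]
  constructor
  · rintro ⟨x, hx, hx'⟩
    have h1 := det3_of_mem_openSegment hx
    have h2 := det3_of_mem_openSegment hx'
    obtain ⟨s, t, hs, ht, hst, rfl⟩ := hx
    obtain ⟨s', t', hs', ht', hst', h⟩ := hx'
    rw [← h, det3_combination _ _ _ _ hst'] at h1
    rw [det3_combination _ _ _ _ hst] at h2
    exact ⟨mul_neg_of_combination hs' ht' hc h1, mul_neg_of_combination hs ht ha h2⟩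
  · rintro ⟨h1, h2⟩
    have hid := det3_four a b c d
    rw [← det3_rotate a c d, ← det3_rotate b c d] at hid
    have hne : det3 a b d - det3 a b c ≠ 0 := by
      intro h
      rw [sub_eq_zero] at h
      rw [h] at h1
      nlinarith [mul_self_nonneg (det3 a b c)]
    -- These are the barycentric weights at which an affine function with end values `x` and `y`
    -- vanishes.
    have key : ∀ x y : ℝ, x ≠ 0 → x * y < 0 → 0 < y / (y - x) ∧ 0 < -x / (y - x) := by
      intro x y hx hxy
      rcases hx.lt_or_gt with hx | hx
      · have : 0 < y := by nlinarith
        exact ⟨by apply div_pos <;> linarith, by apply div_pos <;> linarith⟩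
      · have : y < 0 := by nlinarith
        exact ⟨by apply div_pos_of_neg_of_neg <;> linarith,
          by apply div_pos_of_neg_of_neg <;> linarith⟩
    have hne' : det3 c d b - det3 c d a ≠ 0 := by
      intro h; apply hne; linarith
    obtain ⟨k1, k2⟩ := key _ _ hc h1
    obtain ⟨k3, k4⟩ := key _ _ ha h2
    refine ⟨_, ⟨_, _, k3, k4, by field_simp; ring, rfl⟩, ⟨_, _, k1, k2, by field_simp; ring, ?_⟩⟩
    have hd' : det3 c d b - det3 c d a = -(det3 a b d - det3 a b c) := by linarith
    rw [hd']
    apply plane_ext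
    all_goals
      simp only [PiLp.add_apply, PiLp.smul_apply, smul_eq_mul]
      field_simp
      simp only [det3]
      ring

theorem det3_eq_zero_of_openSegment_inter {a b d : Plane}
    (h : (openSegment ℝ a b ∩ openSegment ℝ a d).Nonempty) : det3 a b d = 0 := by
  obtain ⟨x, hx, s, t, hs, ht, hst, rfl⟩ := h
  have h1 := det3_of_mem_openSegment hx
  rw [det3_combination _ _ _ _ hst] at h1
  have : det3 a b a = 0 := by simp [det3]
  rw [this] at h1
  simpa [ht.ne'] using h1

/-! ### Placements in general position -/

/-- The placement `f` is injective and puts no three points on a line. -/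
structure IsGeneric {V : Type*} (f : V → Plane) : Prop where
  injective : Function.Injective f
  det3_ne_zero : ∀ u v w : V, u ≠ v → u ≠ w → v ≠ w → det3 (f u) (f v) (f w) ≠ 0

theorem IsStraightLineDrawing.isGeneric {V : Type*} {G : SimpleGraph V} {f : V → Plane}
    (h : IsStraightLineDrawing G f) : IsGeneric f :=
  ⟨h.injective, fun u v w h1 h2 h3 h0 =>
    h.not_collinear u v w h1 h2 h3 (collinear_of_det3_eq_zero h0)⟩

/-- In a generic placement the pairs `a b` and `c d` cross, as read off from the orientations. -/
def OrientedCrossing {V : Type*} (f : V → Plane) (a b c d : V) : Prop :=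
  (a ≠ b ∧ a ≠ c ∧ a ≠ d ∧ b ≠ c ∧ b ≠ d ∧ c ≠ d) ∧
    orientationSign (f a) (f b) (f c) ≠ orientationSign (f a) (f b) (f d) ∧
      orientationSign (f c) (f d) (f a) ≠ orientationSign (f c) (f d) (f b)

theorem IsGeneric.inter_nonempty_iff {V : Type*} {f : V → Plane} (hf : IsGeneric f) {a b c d : V}
    (hab : a ≠ b) (hcd : c ≠ d) (hne : s(a, b) ≠ s(c, d)) :
    (openSegment ℝ (f a) (f b) ∩ openSegment ℝ (f c) (f d)).Nonempty ↔
      OrientedCrossing f a b c d := by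
  have aux : ∀ a b d : V, a ≠ b → a ≠ d → b ≠ d →
      ¬ (openSegment ℝ (f a) (f b) ∩ openSegment ℝ (f a) (f d)).Nonempty := fun a b d h1 h2 h3 h =>
    hf.det3_ne_zero a b d h1 h2 h3 (det3_eq_zero_of_openSegment_inter h)
  by_cases hac : a = c
  · subst hac
    have : b ≠ d := by rintro rfl; exact hne rfl
    exact iff_of_false (aux _ _ _ hab hcd this) (fun h => h.1.2.1 rfl)
  by_cases had : a = d
  · subst had
    have : b ≠ c := by rintro rfl; exact hne Sym2.eq_swap
    rw [openSegment_symm ℝ (f c)]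
    exact iff_of_false (aux _ _ _ hab hac this) (fun h => h.1.2.2.1 rfl)
  by_cases hbc : b = c
  · subst hbc
    rw [openSegment_symm ℝ (f a)]
    exact iff_of_false (aux _ _ _ hab.symm hcd had) (fun h => h.1.2.2.2.1 rfl)
  by_cases hbd : b = d
  · subst hbd
    rw [openSegment_symm ℝ (f a), openSegment_symm ℝ (f c)]
    exact iff_of_false (aux _ _ _ hab.symm hbc hac) (fun h => h.1.2.2.2.2.1 rfl)
  rw [openSegment_inter_nonempty_iff (hf.det3_ne_zero _ _ _ hab hac hbc)
    (hf.det3_ne_zero _ _ _ hab had hbd) (hf.det3_ne_zero _ _ _ hcd (Ne.symm hac) (Ne.symm had))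
    (hf.det3_ne_zero _ _ _ hcd (Ne.symm hbc) (Ne.symm hbd))]
  unfold OrientedCrossing
  tauto

theorem edgeInterior_mk {V : Type*} (f : V → Plane) (a b : V) :
    edgeInterior f s(a, b) = openSegment ℝ (f a) (f b) := rfl

open Filter Topology MeasureTheory

/-! ### Perturbing a generic placement into a drawing -/

theorem det3_self_left (p q : Plane) : det3 p p q = 0 := by simp [det3]

theorem det3_self_right (p q : Plane) : det3 p q q = 0 := by simp [det3]; ring

theorem det3_self_outer (p q : Plane) : det3 p q p = 0 := by simp [det3]

theorem exists_det3_ne_zero {p q : Plane} (h : p ≠ q) : ∃ r, det3 p q r ≠ 0 := by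
  refine ⟨!₂[p 0 - (q 1 - p 1), p 1 + (q 0 - p 0)], fun h0 => h ?_⟩
  have : (q 0 - p 0) ^ 2 + (q 1 - p 1) ^ 2 = 0 := by
    simp [det3] at h0; linarith
  have h1 : q 0 - p 0 = 0 := by nlinarith [sq_nonneg (q 0 - p 0), sq_nonneg (q 1 - p 1)]
  have h2 : q 1 - p 1 = 0 := by nlinarith [sq_nonneg (q 0 - p 0), sq_nonneg (q 1 - p 1)]
  exact plane_ext (by linarith) (by linarith)

theorem ae_det3_ne_zero {p q : Plane} (h : p ≠ q) : ∀ᵐ y : Plane, det3 p q y ≠ 0 := by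
  have hne : line[ℝ, p, q] ≠ ⊤ := by
    intro htop
    obtain ⟨r, hr⟩ := exists_det3_ne_zero h
    have hr' : r ∈ line[ℝ, p, q] := by rw [htop]; trivial
    have h3 := collinear_insert_of_mem_affineSpan_pair hr'
    apply hr
    rw [← det3_rotate, ← det3_rotate]
    exact det3_eq_zero_of_collinear h3
  have h0 := Measure.addHaar_affineSubspace (volume : Measure Plane) _ hne
  rw [ae_iff]
  refine measure_mono_null ?_ h0
  intro y hy
  simp only [not_not, Set.mem_ofPred_eq] at hy
  exact (collinear_of_det3_eq_zero hy).mem_affineSpan_of_mem_of_ne (by simp) (by simp) (by simp) h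

/-- Along `c d` the affine function `det3 a b` is not constant, since it vanishes somewhere but not
at `c`. Hence it has only one zero. -/
theorem openSegment_inter_unique {a b c d x y : Plane} (hc : det3 a b c ≠ 0)
    (hx : x ∈ openSegment ℝ a b ∩ openSegment ℝ c d)
    (hy : y ∈ openSegment ℝ a b ∩ openSegment ℝ c d) : x = y := by
  obtain ⟨hx1, s, t, hs, ht, hst, rfl⟩ := hx
  obtain ⟨hy1, s', t', hs', ht', hst', rfl⟩ := hy
  have h1 := det3_of_mem_openSegment hx1
  have h2 := det3_of_mem_openSegment hy1
  rw [det3_combination _ _ _ _ hst] at h1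
  rw [det3_combination _ _ _ _ hst'] at h2
  have h3 := mul_neg_of_combination hs ht hc h1
  have hne : det3 a b c - det3 a b d ≠ 0 := by
    intro h; rw [sub_eq_zero] at h; rw [h] at h3; nlinarith [mul_self_nonneg (det3 a b d)]
  have h4 : (s - s') * (det3 a b c - det3 a b d) = 0 := by
    obtain rfl : t = 1 - s := by linarith
    obtain rfl : t' = 1 - s' := by linarith
    linear_combination h1 - h2
  have h5 : s = s' := by
    have := (mul_eq_zero.1 h4).resolve_right hne
    linarith
  have h6 : t = t' := by linarith
  rw [h5, h6]

theorem continuous_det3 {X : Type*} [TopologicalSpace X] {f g h : X → Plane} (hf : Continuous f)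
    (hg : Continuous g) (hh : Continuous h) : Continuous fun x => det3 (f x) (g x) (h x) := by
  unfold det3; fun_prop

theorem eventually_sign_eq {X : Type*} [TopologicalSpace X] {f : X → ℝ} {x : X}
    (hf : ContinuousAt f x) (h : f x ≠ 0) :
    ∀ᶠ y in 𝓝 x, SignType.sign (f y) = SignType.sign (f x) := by
  rcases h.lt_or_gt with h | h
  · filter_upwards [hf.eventually (eventually_lt_nhds h)] with y hy
    rw [sign_neg h, sign_neg hy]
  · filter_upwards [hf.eventually (eventually_gt_nhds h)] with y hy
    rw [sign_pos h, sign_pos hy]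

theorem orientationSign_eq_zero_of_not_distinct {V : Type*} (f : V → Plane) {u v w : V}
    (h : ¬ (u ≠ v ∧ u ≠ w ∧ v ≠ w)) : orientationSign (f u) (f v) (f w) = 0 := by
  rw [orientationSign_eq, sign_eq_zero_iff]
  by_cases h1 : u = v
  · rw [h1, det3_self_left]
  by_cases h2 : u = w
  · rw [h2, det3_self_outer]
  by_cases h3 : v = w
  · rw [h3, det3_self_right]
  exact absurd ⟨h1, h2, h3⟩ h

theorem IsGeneric.of_sign_eq {V : Type*} {f g : V → Plane} (hf : IsGeneric f)
    (hg : Function.Injective g) (h : ∀ u v w, orientationSign (g u) (g v) (g w) =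
      orientationSign (f u) (f v) (f w)) : IsGeneric g := by
  refine ⟨hg, fun u v w h1 h2 h3 h0 => hf.det3_ne_zero u v w h1 h2 h3 ?_⟩
  have := h u v w
  rw [orientationSign_eq, orientationSign_eq, h0, sign_zero] at this
  exact sign_eq_zero_iff.1 this.symm

/-- The interiors of the three edges `a b`, `c d` and `e g` have a point in common. -/
def Concurrent {V : Type*} (f : V → Plane) (a b c d e g : V) : Prop :=
  (openSegment ℝ (f a) (f b) ∩ openSegment ℝ (f c) (f d) ∩ openSegment ℝ (f e) (f g)).Nonempty

theorem Concurrent.swap {V : Type*} {f : V → Plane} {a b c d e g : V}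
    (h : Concurrent f a b c d e g) : Concurrent f b a c d e g := by
  unfold Concurrent at *
  rwa [openSegment_symm ℝ (f b)]

theorem Concurrent.rotate {V : Type*} {f : V → Plane} {a b c d e g : V}
    (h : Concurrent f a b c d e g) : Concurrent f c d e g a b := by
  obtain ⟨x, ⟨h1, h2⟩, h3⟩ := h
  exact ⟨x, ⟨h2, h3⟩, h1⟩

/-- The two fixed segments meet in at most one point `p`, and `p` differs from `f b` because `b` is
off the line `c d`. Concurrency would put `y` on the line through `f b` and `p`, which is a null
set. -/
theorem ae_not_concurrent {V : Type*} {f : V → Plane} (hf : IsGeneric f)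
    {b c d e g : V} (hn : [b, c, d, e, g].Nodup) :
    ∀ᵐ y : Plane, ¬ (openSegment ℝ y (f b) ∩ openSegment ℝ (f c) (f d) ∩
      openSegment ℝ (f e) (f g)).Nonempty := by
  simp only [List.nodup_cons, List.mem_cons, List.not_mem_nil, not_or, or_false] at hn
  obtain ⟨⟨hbc, hbd, hbe, hbg⟩, ⟨hcd, hce, hcg⟩, ⟨hde, hdg⟩, heg, -⟩ := hn
  by_cases hex : (openSegment ℝ (f c) (f d) ∩ openSegment ℝ (f e) (f g)).Nonempty
  · obtain ⟨p, hp⟩ := hex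
    have hbp : f b ≠ p := by
      rintro h
      apply hf.det3_ne_zero c d b hcd (Ne.symm hbc) (Ne.symm hbd)
      rw [h]
      exact det3_of_mem_openSegment hp.1
    filter_upwards [ae_det3_ne_zero hbp] with y hy
    rintro ⟨x, ⟨hx1, hx2⟩, hx3⟩
    have hxp : x = p :=
      openSegment_inter_unique (hf.det3_ne_zero c d e hcd hce hde) ⟨hx2, hx3⟩ hp
    subst hxp
    apply hy
    rw [det3_rotate]
    exact det3_of_mem_openSegment hx1
  · refine Eventually.of_forall fun y => ?_
    rintro ⟨x, ⟨-, hx2⟩, hx3⟩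
    exact hex ⟨x, hx2, hx3⟩

/-- Keeping all orientations and staying distinct is an open condition on the new position of `v`.
Avoiding concurrency holds almost everywhere, hence on a dense set, and the two conditions can be
met together. -/
theorem exists_move_vertex {V : Type*} [Finite V] {f : V → Plane} (hf : IsGeneric f) (v : V) :
    ∃ g : V → Plane, IsGeneric g ∧ (∀ u, u ≠ v → g u = f u) ∧
      (∀ u w z, orientationSign (g u) (g w) (g z) = orientationSign (f u) (f w) (f z)) ∧
      ∀ b c d e h : V, [v, b, c, d, e, h].Nodup → ¬ Concurrent g v b c d e h := by
  classical
  have hcont : ∀ u, Continuous fun y => Function.update f v y u := by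
    intro u
    by_cases hu : u = v
    · subst hu; simpa using continuous_id'
    · simpa [hu] using continuous_const
  have h1 : ∀ᶠ y in 𝓝 (f v), ∀ u w z,
      orientationSign (Function.update f v y u) (Function.update f v y w)
        (Function.update f v y z) = orientationSign (f u) (f w) (f z) := by
    simp only [eventually_all]
    intro u w z
    by_cases hd : u ≠ w ∧ u ≠ z ∧ w ≠ z
    · have := eventually_sign_eq (x := f v)
        (continuous_det3 (hcont u) (hcont w) (hcont z)).continuousAt
        (by simpa using hf.det3_ne_zero u w z hd.1 hd.2.1 hd.2.2)
      simpa [orientationSign_eq] using this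
    · exact Eventually.of_forall fun y => by
        rw [orientationSign_eq_zero_of_not_distinct _ hd,
          orientationSign_eq_zero_of_not_distinct _ hd]
  have h2 : ∀ᶠ y in 𝓝 (f v), ∀ u, u ≠ v → y ≠ f u := by
    simp only [eventually_all]
    intro u hu
    exact eventually_ne_nhds (hf.injective.ne (Ne.symm hu))
  have h3 : ∀ᵐ y : Plane, ∀ b c d e h : V, [v, b, c, d, e, h].Nodup →
      ¬ (openSegment ℝ y (f b) ∩ openSegment ℝ (f c) (f d) ∩
        openSegment ℝ (f e) (f h)).Nonempty := by
    simp only [eventually_all]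
    intro b c d e h hn
    exact ae_not_concurrent hf (List.nodup_cons.1 hn).2
  obtain ⟨U, hU, hUo, hvU⟩ := eventually_nhds_iff.1 (h1.and h2)
  obtain ⟨y, hyU, hy⟩ := (Measure.dense_of_ae h3).inter_open_nonempty U hUo ⟨_, hvU⟩
  obtain ⟨hy1, hy2⟩ := hU y hyU
  have hupd : ∀ u, u ≠ v → Function.update f v y u = f u := fun u hu => by simp [hu]
  refine ⟨Function.update f v y, hf.of_sign_eq ?_ hy1, hupd, hy1, ?_⟩
  · intro u w huw
    by_cases hu : u = v <;> by_cases hw : w = v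
    · rw [hu, hw]
    · subst hu
      rw [Function.update_self, hupd w hw] at huw
      exact absurd huw (hy2 w hw)
    · subst hw
      rw [Function.update_self, hupd u hu] at huw
      exact absurd huw.symm (hy2 u hu)
    · rw [hupd u hu, hupd w hw] at huw
      exact hf.injective huw
  · intro b c d e h hn hcon
    refine hy b c d e h hn ?_
    simp only [List.nodup_cons, List.mem_cons, List.not_mem_nil, not_or, or_false] at hn
    obtain ⟨⟨hb, hc, hd, he, hh⟩, -⟩ := hn
    unfold Concurrent at hcon
    rwa [Function.update_self, hupd b (Ne.symm hb), hupd c (Ne.symm hc), hupd d (Ne.symm hd),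
      hupd e (Ne.symm he), hupd h (Ne.symm hh)] at hcon

theorem Concurrent.congr {V : Type*} {f g : V → Plane} {a b c d e h : V}
    (hc : Concurrent f a b c d e h) (hfg : ∀ u ∈ [a, b, c, d, e, h], g u = f u) :
    Concurrent g a b c d e h := by
  unfold Concurrent at *
  rwa [hfg a (by simp), hfg b (by simp), hfg c (by simp), hfg d (by simp), hfg e (by simp),
    hfg h (by simp)]

theorem exists_not_concurrent_on {V : Type*} [Finite V] {f : V → Plane} (hf : IsGeneric f)
    (S : Finset V) :
    ∃ g : V → Plane, IsGeneric g ∧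
      (∀ u w z, orientationSign (g u) (g w) (g z) = orientationSign (f u) (f w) (f z)) ∧
      ∀ a b c d e h : V, [a, b, c, d, e, h].Nodup → (∀ u ∈ [a, b, c, d, e, h], u ∈ S) →
        ¬ Concurrent g a b c d e h := by
  classical
  induction S using Finset.induction_on with
  | empty => exact ⟨f, hf, fun _ _ _ => rfl, fun a b c d e h _ hS => by simpa using hS a (by simp)⟩
  | insert v S hv ih =>
    obtain ⟨g, hg, hsign, hcon⟩ := ih
    obtain ⟨g', hg', heq, hsign', hcon'⟩ := exists_move_vertex hg v
    refine ⟨g', hg', fun u w z => (hsign' u w z).trans (hsign u w z), ?_⟩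
    intro a b c d e h hn hS hc
    -- Triples of edges through `v` are handled by the latest move, after a symmetry that brings `v`
    -- to the front. All others have kept their positions.
    by_cases hmem : v ∈ [a, b, c, d, e, h]
    · have hn' := hn
      simp only [List.nodup_cons, List.mem_cons, List.not_mem_nil, not_or, or_false] at hn'
      simp only [List.mem_cons, List.not_mem_nil, or_false] at hmem
      rcases hmem with rfl | rfl | rfl | rfl | rfl | rfl
      · exact hcon' _ _ _ _ _ hn hc
      · refine hcon' _ _ _ _ _ ?_ hc.swap
        simp; tauto
      · refine hcon' _ _ _ _ _ ?_ hc.rotate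
        simp; tauto
      · refine hcon' _ _ _ _ _ ?_ hc.rotate.swap
        simp; tauto
      · refine hcon' _ _ _ _ _ ?_ hc.rotate.rotate
        simp; tauto
      · refine hcon' _ _ _ _ _ ?_ hc.rotate.rotate.swap
        simp; tauto
    · have hne : ∀ u ∈ [a, b, c, d, e, h], u ≠ v := by
        rintro u hu rfl
        exact hmem hu
      refine hcon a b c d e h hn (fun u hu => ?_) (hc.congr fun u hu => (heq u (hne u hu)).symm)
      exact (Finset.mem_insert.1 (hS u hu)).resolve_left (hne u hu)

/-- A generic placement can be perturbed, without changing orientations, into a straight-line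
drawing of every graph on the same vertices. -/
theorem IsGeneric.exists_drawing {V : Type*} [Finite V] {f : V → Plane} (hf : IsGeneric f) :
    ∃ g : V → Plane, IsGeneric g ∧ (∀ G : SimpleGraph V, IsStraightLineDrawing G g) ∧
      ∀ u w z, orientationSign (g u) (g w) (g z) = orientationSign (f u) (f w) (f z) := by
  have := Fintype.ofFinite V
  obtain ⟨g, hg, hsign, hcon⟩ := exists_not_concurrent_on hf Finset.univ
  refine ⟨g, hg, fun G => ⟨hg.injective, fun u v w h1 h2 h3 h => hg.det3_ne_zero u v w h1 h2 h3
    (det3_eq_zero_of_collinear h), ?_⟩, hsign⟩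
  intro e₁ he₁ e₂ he₂ e₃ he₃ h12 h13 h23
  induction e₁ using Sym2.ind with | _ a b
  induction e₂ using Sym2.ind with | _ c d
  induction e₃ using Sym2.ind with | _ e h
  rw [SimpleGraph.mem_edgeSet] at he₁ he₂ he₃
  rw [← Set.not_nonempty_iff_eq_empty]
  simp only [edgeInterior_mk]
  intro hne
  obtain ⟨x, ⟨hx1, hx2⟩, hx3⟩ := id hne
  have d1 := ((hg.inter_nonempty_iff he₁.ne he₂.ne h12).1 ⟨x, hx1, hx2⟩).1
  have d2 := ((hg.inter_nonempty_iff he₁.ne he₃.ne h13).1 ⟨x, hx1, hx3⟩).1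
  have d3 := ((hg.inter_nonempty_iff he₂.ne he₃.ne h23).1 ⟨x, hx2, hx3⟩).1
  refine hcon a b c d e h ?_ (by simp) hne
  simp; tauto

/-- Distinct points of a parabola work: the determinant is a Vandermonde product. -/
theorem exists_isGeneric (V : Type*) [Finite V] : ∃ f : V → Plane, IsGeneric f := by
  obtain ⟨n, ⟨e⟩⟩ := Finite.exists_equiv_fin V
  have hinj : ∀ u v : V, u ≠ v → ((e u : ℕ) : ℝ) ≠ ((e v : ℕ) : ℝ) := by
    intro u v h h'
    exact h (e.injective (Fin.ext (by exact_mod_cast h')))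
  refine ⟨fun v => !₂[((e v : ℕ) : ℝ), ((e v : ℕ) : ℝ) ^ 2], ⟨fun u v h => ?_, ?_⟩⟩
  · by_contra hne
    exact hinj u v hne (by simpa using congrArg (fun p : Plane => p 0) h)
  · intro u v w h1 h2 h3
    have : ∀ a b c : ℝ, det3 !₂[a, a ^ 2] !₂[b, b ^ 2] !₂[c, c ^ 2] =
        (b - a) * (c - a) * (c - b) := by
      intro a b c; simp [det3]; ring
    rw [this]
    exact mul_ne_zero (mul_ne_zero (sub_ne_zero.2 (hinj _ _ h1.symm))
      (sub_ne_zero.2 (hinj _ _ h2.symm))) (sub_ne_zero.2 (hinj _ _ h3.symm))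

/-! ### Weighted crossings as a sum over quadruples of vertices -/

theorem sum_sum_sym2 {V : Type*} [Fintype V] (h : Sym2 V → ℝ) (h0 : ∀ v, h s(v, v) = 0) :
    ∑ a, ∑ b, h s(a, b) = 2 * ∑ e, h e := by
  classical
  rw [← Fintype.sum_prod_type' (f := fun a b => h s(a, b)),
    ← Finset.sum_fiberwise_of_maps_to (s := Finset.univ) (t := Finset.univ)
      (g := fun p : V × V => s(p.1, p.2)) (fun _ _ => Finset.mem_univ _), Finset.mul_sum]
  refine Finset.sum_congr rfl fun e _ => ?_
  induction e using Sym2.ind with | _ a b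
  rw [Finset.sum_congr rfl (g := fun _ => h s(a, b))
    (fun p hp => by rw [(Finset.mem_filter.1 hp).2]), Finset.sum_const, nsmul_eq_mul]
  by_cases hab : a = b
  · rw [hab, h0, mul_zero, mul_zero]
  · have : Finset.univ.filter (fun p : V × V => s(p.1, p.2) = s(a, b)) = {(a, b), (b, a)} := by
      ext ⟨x, y⟩; simp
    rw [this, Finset.card_pair (by simp [hab])]
    norm_num

open Classical in
/-- The total weight, over the ordered quadruples `a b c d` of vertices for which `a b` crosses
`c d`, of the product of the weights of `a b` and `c d`. -/
noncomputable def orientedCrossingSum {V : Type*} [Fintype V] (w : Sym2 V → ℝ)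
    (f : V → Plane) : ℝ :=
  ∑ a, ∑ b, ∑ c, ∑ d, if OrientedCrossing f a b c d then w s(a, b) * w s(c, d) else 0

open Classical in
theorem two_mul_weightedCrossings {V : Type*} [Fintype V] (G : EdgeWeightedGraph V)
    (f : V → Plane) : 2 * G.weightedCrossings f = ∑ e₁, ∑ e₂,
      if e₁ ≠ e₂ ∧ (edgeInterior f e₁ ∩ edgeInterior f e₂).Nonempty then
        G.weight e₁ * G.weight e₂ else 0 := by
  let T : Finset (Sym2 V × Sym2 V) := Finset.univ.filter fun p =>
    p.1 ∈ G.graph.edgeSet ∧ p.2 ∈ G.graph.edgeSet ∧ p.1 ≠ p.2 ∧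
      (edgeInterior f p.1 ∩ edgeInterior f p.2).Nonempty
  have hT : ∑ p ∈ T, G.weight p.1 * G.weight p.2 = ∑ e₁, ∑ e₂,
      if e₁ ≠ e₂ ∧ (edgeInterior f e₁ ∩ edgeInterior f e₂).Nonempty then
        G.weight e₁ * G.weight e₂ else 0 := by
    rw [← Fintype.sum_prod_type', Finset.sum_filter]
    refine Finset.sum_congr rfl fun p _ => ?_
    by_cases h1 : p.1 ∈ G.graph.edgeSet
    · by_cases h2 : p.2 ∈ G.graph.edgeSet
      · simp [h1, h2]
      · simp [G.weight_eq_zero _ h2]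
    · simp [G.weight_eq_zero _ h1]
  rw [← hT, EdgeWeightedGraph.weightedCrossings, Finset.mul_sum,
    ← Finset.sum_fiberwise_of_maps_to (s := T) (t := crossingPairs G.graph f)
      (g := fun p => ({p.1, p.2} : Finset (Sym2 V)))]
  · refine Finset.sum_congr rfl fun X hX => ?_
    simp only [crossingPairs, Finset.mem_filter, Finset.mem_univ, true_and] at hX
    obtain ⟨hc, hE, hne⟩ := hX
    obtain ⟨x, y, hxy, rfl⟩ := Finset.card_eq_two.1 hc
    have hx : x ∈ G.graph.edgeSet := hE (by simp)
    have hy : y ∈ G.graph.edgeSet := hE (by simp)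
    have hne' : (edgeInterior f x ∩ edgeInterior f y).Nonempty := by simpa using hne
    have hfib : T.filter (fun p => ({p.1, p.2} : Finset (Sym2 V)) = {x, y}) =
        {(x, y), (y, x)} := by
      ext ⟨p, q⟩
      simp only [T, Finset.mem_filter, Finset.mem_univ, true_and, Finset.mem_insert,
        Finset.mem_singleton, Prod.mk.injEq]
      constructor
      · rintro ⟨⟨-, -, hpq, -⟩, h⟩
        have h1 : p ∈ ({x, y} : Finset (Sym2 V)) := by rw [← h]; simp
        have h2 : q ∈ ({x, y} : Finset (Sym2 V)) := by rw [← h]; simp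
        simp only [Finset.mem_insert, Finset.mem_singleton] at h1 h2
        rcases h1 with rfl | rfl <;> rcases h2 with rfl | rfl <;> simp_all
      · rintro (⟨rfl, rfl⟩ | ⟨rfl, rfl⟩)
        · exact ⟨⟨hx, hy, hxy, hne'⟩, rfl⟩
        · exact ⟨⟨hy, hx, hxy.symm, by rwa [Set.inter_comm]⟩, Finset.pair_comm _ _⟩
    rw [hfib, Finset.sum_pair (by simp [hxy]), Finset.prod_pair hxy]
    ring
  · intro p hp
    simp only [T, Finset.mem_filter, Finset.mem_univ, true_and] at hp
    obtain ⟨h1, h2, h3, h4⟩ := hp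
    simp only [crossingPairs, Finset.mem_filter, Finset.mem_univ, true_and]
    refine ⟨Finset.card_pair h3, ?_, by simpa using h4⟩
    intro e he
    simp only [Finset.coe_insert, Finset.coe_singleton, Set.mem_insert_iff,
      Set.mem_singleton_iff] at he
    rcases he with rfl | rfl <;> assumption

theorem EdgeWeightedGraph.weight_diag {V : Type*} (G : EdgeWeightedGraph V) (v : V) :
    G.weight s(v, v) = 0 :=
  G.weight_eq_zero _ (by simp)

theorem EdgeWeightedGraph.weight_nonneg {V : Type*} (G : EdgeWeightedGraph V) (e : Sym2 V) :
    0 ≤ G.weight e := by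
  by_cases h : e ∈ G.graph.edgeSet
  · exact (G.weight_mem e h).1
  · exact (G.weight_eq_zero e h).ge

theorem EdgeWeightedGraph.weight_le_one {V : Type*} (G : EdgeWeightedGraph V) (e : Sym2 V) :
    G.weight e ≤ 1 := by
  by_cases h : e ∈ G.graph.edgeSet
  · exact (G.weight_mem e h).2
  · rw [G.weight_eq_zero e h]; exact zero_le_one

/-- The factor 8 counts the two orders of the crossing pair and the two directions of each edge. -/
theorem IsGeneric.orientedCrossingSum_eq {V : Type*} [Fintype V] (G : EdgeWeightedGraph V)
    {f : V → Plane} (hf : IsGeneric f) :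
    orientedCrossingSum G.weight f = 8 * G.weightedCrossings f := by
  classical
  have h8 : 8 * G.weightedCrossings f = 2 * (2 * (2 * G.weightedCrossings f)) := by ring
  rw [h8, two_mul_weightedCrossings, ← sum_sum_sym2, Finset.mul_sum, orientedCrossingSum]
  · refine Finset.sum_congr rfl fun a _ => ?_
    rw [Finset.mul_sum]
    refine Finset.sum_congr rfl fun b _ => ?_
    rw [← sum_sum_sym2]
    · refine Finset.sum_congr rfl fun c _ => Finset.sum_congr rfl fun d _ => ?_
      by_cases hab : a = b
      · simp [hab, G.weight_diag]
      by_cases hcd : c = d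
      · simp [hcd, G.weight_diag]
      by_cases hne : s(a, b) = s(c, d)
      · have : ¬ OrientedCrossing f a b c d := by
          rintro ⟨⟨-, h1, h2, -, -, -⟩, -⟩
          rcases Sym2.eq_iff.1 hne with h | h
          · exact h1 h.1
          · exact h2 h.1
        simp [this, hne]
      · simp only [edgeInterior_mk, hf.inter_nonempty_iff hab hcd hne, ne_eq, hne,
          not_false_eq_true, true_and]
    · intro v; simp [G.weight_diag]
  · intro v; simp [G.weight_diag]

theorem orientedCrossing_congr {V : Type*} {f g : V → Plane}
    (h : ∀ u w z, orientationSign (g u) (g w) (g z) = orientationSign (f u) (f w) (f z))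
    (a b c d : V) : OrientedCrossing g a b c d ↔ OrientedCrossing f a b c d := by
  unfold OrientedCrossing
  simp only [h]

theorem EdgeWeightedGraph.weightedCrossings_nonneg {V : Type*} [Fintype V]
    (G : EdgeWeightedGraph V) (f : V → Plane) : 0 ≤ G.weightedCrossings f :=
  Finset.sum_nonneg fun _ _ => Finset.prod_nonneg fun e _ => G.weight_nonneg e

open Classical in
-- In a generic placement the crossing weight depends only on orientations, so it is shared by a
-- nearby drawing. Concurrent edges may therefore be ignored from here on.
theorem EdgeWeightedGraph.rectilinearCrossingNumber_le {V : Type*} [Fintype V]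
    (G : EdgeWeightedGraph V) {f : V → Plane} (hf : IsGeneric f) :
    G.rectilinearCrossingNumber ≤ G.weightedCrossings f := by
  obtain ⟨g, hg, hdraw, hsign⟩ := hf.exists_drawing
  have : G.weightedCrossings g = G.weightedCrossings f := by
    have h1 := hg.orientedCrossingSum_eq G
    have h2 := hf.orientedCrossingSum_eq G
    have h3 : orientedCrossingSum G.weight g = orientedCrossingSum G.weight f :=
      Finset.sum_congr rfl fun a _ => Finset.sum_congr rfl fun b _ =>
        Finset.sum_congr rfl fun c _ => Finset.sum_congr rfl fun d _ =>
          if_congr (orientedCrossing_congr hsign a b c d) rfl rfl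
    linarith
  rw [← this]
  refine csInf_le ⟨0, ?_⟩ ⟨g, hdraw _, rfl⟩
  rintro x ⟨g', -, rfl⟩
  exact G.weightedCrossings_nonneg g'

theorem EdgeWeightedGraph.le_rectilinearCrossingNumber {V : Type*} [Fintype V]
    (G : EdgeWeightedGraph V) {x : ℝ}
    (h : ∀ f : V → Plane, IsGeneric f → x ≤ G.weightedCrossings f) :
    x ≤ G.rectilinearCrossingNumber := by
  obtain ⟨f, hf⟩ := exists_isGeneric V
  obtain ⟨g, -, hdraw, -⟩ := hf.exists_drawing
  refine le_csInf ⟨_, g, hdraw _, rfl⟩ ?_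
  rintro y ⟨g', hg', rfl⟩
  exact h g' hg'.isGeneric

/-- Crossing numbers are close if the crossing sums are close for every generic placement. -/
theorem EdgeWeightedGraph.abs_rectilinearCrossingNumber_sub_le {V : Type*} [Fintype V]
    (G G' : EdgeWeightedGraph V) {η : ℝ}
    (h : ∀ f : V → Plane, IsGeneric f →
      |orientedCrossingSum G.weight f - orientedCrossingSum G'.weight f| ≤ 8 * η) :
    |G.rectilinearCrossingNumber - G'.rectilinearCrossingNumber| ≤ η := by
  have h' : ∀ f : V → Plane, IsGeneric f →
      |G.weightedCrossings f - G'.weightedCrossings f| ≤ η := by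
    intro f hf
    have := h f hf
    rw [hf.orientedCrossingSum_eq, hf.orientedCrossingSum_eq, ← mul_sub, abs_mul] at this
    norm_num at this
    exact this
  have h1 : G.rectilinearCrossingNumber - η ≤ G'.rectilinearCrossingNumber :=
    G'.le_rectilinearCrossingNumber fun f hf => by
      have := (abs_le.1 (h' f hf)).2
      linarith [G.rectilinearCrossingNumber_le hf]
  have h2 : G'.rectilinearCrossingNumber - η ≤ G.rectilinearCrossingNumber :=
    G.le_rectilinearCrossingNumber fun f hf => by
      have := (abs_le.1 (h' f hf)).1
      linarith [G'.rectilinearCrossingNumber_le hf]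
  exact abs_le.2 ⟨by linarith, by linarith⟩

/-! ### Comparing crossing sums of graphs that are close in cut-distance -/

open Classical in
theorem sum_sum_fiberwise {α κ : Type*} [Fintype α] [Fintype κ] (q : α → κ) (Z : κ → κ → Prop)
    (g : α → α → ℝ) :
    ∑ x, ∑ y, (if Z (q x) (q y) then g x y else 0) =
      ∑ i, ∑ j, if Z i j then
        ∑ x ∈ Finset.univ.filter (q · = i), ∑ y ∈ Finset.univ.filter (q · = j), g x y else 0 := by
  rw [← Finset.sum_fiberwise Finset.univ q]
  refine Finset.sum_congr rfl fun i _ => ?_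
  calc _ = ∑ x ∈ Finset.univ.filter (q · = i), ∑ j,
        if Z i j then ∑ y ∈ Finset.univ.filter (q · = j), g x y else 0 := by
        refine Finset.sum_congr rfl fun x hx => ?_
        rw [← Finset.sum_fiberwise Finset.univ q]
        refine Finset.sum_congr rfl fun j _ => ?_
        rw [(Finset.mem_filter.1 hx).2]
        split_ifs with h
        · refine Finset.sum_congr rfl fun y hy => ?_
          rw [(Finset.mem_filter.1 hy).2, if_pos h]
        · refine Finset.sum_eq_zero fun y hy => ?_
          rw [(Finset.mem_filter.1 hy).2, if_neg h]
    _ = _ := by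
        rw [Finset.sum_comm]
        refine Finset.sum_congr rfl fun j _ => ?_
        split_ifs <;> simp

open Classical in
-- Replacing `Y` by the blockwise relation `Z` costs at most 1 for each mismatched pair. Over a
-- block (i, j) the sum factors as a product of block weights, and e_i e_j - e'_i e'_j = (e_i -
-- e'_i) e_j + e'_i (e_j - e'_j). Since all block weights together sum to at most |α|, the bound is
-- linear, not quadratic, in the number of blocks.
theorem abs_sum_mul_sub_mul_le {α κ : Type*} [Fintype α] [Fintype κ] (q : α → κ)
    (w w' : α → ℝ) (hw : ∀ x, w x ∈ Set.Icc (0 : ℝ) 1) (hw' : ∀ x, w' x ∈ Set.Icc (0 : ℝ) 1)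
    {η : ℝ} (hη : 0 ≤ η) (h : ∀ i, |∑ x ∈ Finset.univ.filter (q · = i), w x -
      ∑ x ∈ Finset.univ.filter (q · = i), w' x| ≤ η)
    (Y : α → α → Prop) (Z : κ → κ → Prop) :
    |∑ x, ∑ y, (if Y x y then w x * w y else 0) - ∑ x, ∑ y, (if Y x y then w' x * w' y else 0)| ≤
      2 * η * Fintype.card κ * Fintype.card α +
        ∑ x, ∑ y, (if Y x y ↔ Z (q x) (q y) then (0 : ℝ) else 1) := by
  have hprod : ∀ x y, |w x * w y - w' x * w' y| ≤ 1 := by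
    intro x y
    obtain ⟨h1, h2⟩ := hw x
    obtain ⟨h3, h4⟩ := hw y
    obtain ⟨h5, h6⟩ := hw' x
    obtain ⟨h7, h8⟩ := hw' y
    rw [abs_le]
    constructor <;> nlinarith [mul_nonneg h1 h3, mul_nonneg h5 h7, mul_le_one₀ h2 h3 h4,
      mul_le_one₀ h6 h7 h8]
  set e : κ → ℝ := fun i => ∑ x ∈ Finset.univ.filter (q · = i), w x with he
  set e' : κ → ℝ := fun i => ∑ x ∈ Finset.univ.filter (q · = i), w' x with he'
  have he0 : ∀ i, 0 ≤ e i := fun i => Finset.sum_nonneg fun x _ => (hw x).1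
  have he0' : ∀ i, 0 ≤ e' i := fun i => Finset.sum_nonneg fun x _ => (hw' x).1
  have hes : ∑ i, e i ≤ Fintype.card α := by
    calc ∑ i, e i = ∑ x, w x := Finset.sum_fiberwise Finset.univ q w
      _ ≤ ∑ _x : α, (1 : ℝ) := Finset.sum_le_sum fun x _ => (hw x).2
      _ = _ := by simp
  have hes' : ∑ i, e' i ≤ Fintype.card α := by
    calc ∑ i, e' i = ∑ x, w' x := Finset.sum_fiberwise Finset.univ q w'
      _ ≤ ∑ _x : α, (1 : ℝ) := Finset.sum_le_sum fun x _ => (hw' x).2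
      _ = _ := by simp
  have hZ : |∑ x, ∑ y, (if Z (q x) (q y) then w x * w y - w' x * w' y else 0)| ≤
      2 * η * Fintype.card κ * Fintype.card α := by
    rw [sum_sum_fiberwise]
    calc _ ≤ ∑ i, ∑ j, |if Z i j then
        ∑ x ∈ Finset.univ.filter (q · = i), ∑ y ∈ Finset.univ.filter (q · = j),
          (w x * w y - w' x * w' y) else 0| :=
          (Finset.abs_sum_le_sum_abs _ _).trans
            (Finset.sum_le_sum fun i _ => Finset.abs_sum_le_sum_abs _ _)
      _ ≤ ∑ i, ∑ j, (η * e j + η * e' i) := by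
          refine Finset.sum_le_sum fun i _ => Finset.sum_le_sum fun j _ => ?_
          have hnn : 0 ≤ η * e j + η * e' i :=
            add_nonneg (mul_nonneg hη (he0 j)) (mul_nonneg hη (he0' i))
          split_ifs
          · simp only [Finset.sum_sub_distrib, ← Finset.mul_sum, ← Finset.sum_mul]
            change |e i * e j - e' i * e' j| ≤ _
            have : e i * e j - e' i * e' j = (e i - e' i) * e j + e' i * (e j - e' j) := by ring
            rw [this]
            refine (abs_add_le _ _).trans (add_le_add ?_ ?_)
            · rw [abs_mul, abs_of_nonneg (he0 j)]
              exact mul_le_mul_of_nonneg_right (h i) (he0 j)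
            · rw [abs_mul, abs_of_nonneg (he0' i), mul_comm]
              exact mul_le_mul_of_nonneg_right (h j) (he0' i)
          · simpa using hnn
      _ = η * Fintype.card κ * (∑ i, e i + ∑ i, e' i) := by
          simp only [Finset.sum_add_distrib, ← Finset.mul_sum, Finset.sum_const, nsmul_eq_mul,
            Finset.card_univ]
          ring
      _ ≤ η * Fintype.card κ * (Fintype.card α + Fintype.card α) := by gcongr
      _ = _ := by ring
  have hD : |∑ x, ∑ y, ((if Y x y then w x * w y - w' x * w' y else 0) -
      (if Z (q x) (q y) then w x * w y - w' x * w' y else 0))| ≤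
      ∑ x, ∑ y, (if Y x y ↔ Z (q x) (q y) then (0 : ℝ) else 1) := by
    refine (Finset.abs_sum_le_sum_abs _ _).trans (Finset.sum_le_sum fun x _ =>
      (Finset.abs_sum_le_sum_abs _ _).trans (Finset.sum_le_sum fun y _ => ?_))
    by_cases h1 : Y x y <;> by_cases h2 : Z (q x) (q y) <;> simp [h1, h2, hprod]
    rw [abs_sub_comm]; exact hprod x y
  have hsplit : ∑ x, ∑ y, (if Y x y then w x * w y else 0) -
      ∑ x, ∑ y, (if Y x y then w' x * w' y else 0) =
      ∑ x, ∑ y, (if Z (q x) (q y) then w x * w y - w' x * w' y else 0) +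
      ∑ x, ∑ y, ((if Y x y then w x * w y - w' x * w' y else 0) -
        (if Z (q x) (q y) then w x * w y - w' x * w' y else 0)) := by
    simp only [← Finset.sum_sub_distrib, ← Finset.sum_add_distrib]
    refine Finset.sum_congr rfl fun x _ => Finset.sum_congr rfl fun y _ => ?_
    split_ifs <;> ring
  rw [hsplit]
  exact (abs_add_le _ _).trans (add_le_add hZ hD)

theorem orientedCrossingSum_eq_sum_pairs {V : Type*} [Fintype V] (w : Sym2 V → ℝ)
    (f : V → Plane) [∀ x y : V × V, Decidable (OrientedCrossing f x.1 x.2 y.1 y.2)] :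
    orientedCrossingSum w f = ∑ x : V × V, ∑ y : V × V,
      if OrientedCrossing f x.1 x.2 y.1 y.2 then w s(x.1, x.2) * w s(y.1, y.2) else 0 := by
  simp only [Fintype.sum_prod_type, orientedCrossingSum]
  refine Finset.sum_congr rfl fun a _ => Finset.sum_congr rfl fun b _ =>
    Finset.sum_congr rfl fun c _ => Finset.sum_congr rfl fun d _ => ?_
  congr

theorem EdgeWeightedGraph.abs_cutWeight_sub_le {V : Type*} [Fintype V]
    (G G' : EdgeWeightedGraph V) (S T : Finset V) :
    |G.cutWeight S T - G'.cutWeight S T| ≤ G.cutDistance G' :=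
  Finset.le_sup' (fun p : Finset V × Finset V => |G.cutWeight p.1 p.2 - G'.cutWeight p.1 p.2|)
    (Finset.mem_univ (S, T))

open Classical in
/-- If the crossing pattern of the placement `f` is given, up to the pairs counted by the last sum,
by the classes of the vertices under `p`, then the crossing sums of graphs that are close in
cut-distance are close. -/
theorem abs_orientedCrossingSum_sub_le {V ι : Type*} [Fintype V] [Fintype ι]
    (G G' : EdgeWeightedGraph V) (f : V → Plane) (p : V → ι) (Z : ι × ι → ι × ι → Prop) :
    |orientedCrossingSum G.weight f - orientedCrossingSum G'.weight f| ≤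
      2 * G.cutDistance G' * (Fintype.card ι : ℝ) ^ 2 * (Fintype.card V : ℝ) ^ 2 +
        ∑ x : V × V, ∑ y : V × V, (if OrientedCrossing f x.1 x.2 y.1 y.2 ↔
          Z (p x.1, p x.2) (p y.1, p y.2) then (0 : ℝ) else 1) := by
  have hη : 0 ≤ G.cutDistance G' := (abs_nonneg _).trans (G.abs_cutWeight_sub_le G' ∅ ∅)
  have key := abs_sum_mul_sub_mul_le (fun x : V × V => (p x.1, p x.2))
    (fun x => G.weight s(x.1, x.2)) (fun x => G'.weight s(x.1, x.2))
    (fun x => ⟨G.weight_nonneg _, G.weight_le_one _⟩)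
    (fun x => ⟨G'.weight_nonneg _, G'.weight_le_one _⟩) hη ?_
    (fun x y => OrientedCrossing f x.1 x.2 y.1 y.2) Z
  · rw [orientedCrossingSum_eq_sum_pairs, orientedCrossingSum_eq_sum_pairs]
    refine key.trans (le_of_eq ?_)
    simp only [Fintype.card_prod, Nat.cast_mul]
    ring
  · rintro ⟨i, j⟩
    refine le_trans (le_of_eq ?_) (G.abs_cutWeight_sub_le G' (Finset.univ.filter (p · = i))
      (Finset.univ.filter (p · = j)))
    simp only [EdgeWeightedGraph.cutWeight]
    rw [← Finset.sum_product', ← Finset.sum_product']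
    congr 2 <;> exact Finset.sum_congr (by ext ⟨a, b⟩; simp) fun _ _ => rfl

theorem orientedCrossingSum_mem_Icc {V : Type*} [Fintype V] (G : EdgeWeightedGraph V)
    (f : V → Plane) :
    orientedCrossingSum G.weight f ∈ Set.Icc (0 : ℝ) ((Fintype.card V : ℝ) ^ 4) := by
  classical
  rw [orientedCrossingSum_eq_sum_pairs]
  have h0 : ∀ x y : V × V, 0 ≤ G.weight s(x.1, x.2) * G.weight s(y.1, y.2) := fun x y =>
    mul_nonneg (G.weight_nonneg _) (G.weight_nonneg _)
  constructor
  · refine Finset.sum_nonneg fun x _ => Finset.sum_nonneg fun y _ => ?_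
    split_ifs
    · exact h0 x y
    · exact le_rfl
  · calc _ ≤ ∑ x : V × V, ∑ y : V × V, (1 : ℝ) := by
          refine Finset.sum_le_sum fun x _ => Finset.sum_le_sum fun y _ => ?_
          split_ifs
          · exact mul_le_one₀ (G.weight_le_one _) (G.weight_nonneg _) (G.weight_le_one _)
          · exact zero_le_one
      _ = _ := by simp; ring

/-! ### Crossing sums and same-type partitions -/

theorem orientationSign_swap (p q r : Plane) : orientationSign p r q = -orientationSign p q r := by
  rw [orientationSign_eq, orientationSign_eq, det3_swap, Left.sign_neg]

theorem orientationSign_swap_left (p q r : Plane) :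
    orientationSign q p r = -orientationSign p q r := by
  rw [orientationSign_eq, orientationSign_eq, det3_swap_left, Left.sign_neg]

/-- The definition only treats increasing indices. Antisymmetry covers the other orders, and
repeated indices give sign 0 on both sides. -/
theorem HasSameTypeTransversals.orientationSign_congr {K : ℕ} {A : Fin K → Finset Plane}
    {s : Finset (Fin K)} (h : HasSameTypeTransversals A s) {f g : Fin K → Plane}
    (hf : ∀ i ∈ s, f i ∈ A i) (hg : ∀ i ∈ s, g i ∈ A i) {i j k : Fin K} (hi : i ∈ s) (hj : j ∈ s)
    (hk : k ∈ s) : orientationSign (f i) (f j) (f k) = orientationSign (g i) (g j) (g k) := by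
  have h0 : ∀ i ∈ s, ∀ j ∈ s, ∀ k ∈ s, i < j → j < k → _ := h f g hf hg
  have h1 : ∀ i ∈ s, ∀ j ∈ s, ∀ k ∈ s, i < k → j < k →
      orientationSign (f i) (f j) (f k) = orientationSign (g i) (g j) (g k) := by
    intro i hi j hj k hk hik hjk
    rcases lt_trichotomy i j with hij | rfl | hij
    · exact h0 i hi j hj k hk hij hjk
    · simp [orientationSign_eq, det3_self_left]
    · rw [orientationSign_swap_left (f j), orientationSign_swap_left (g j),
        h0 j hj i hi k hk hij hik]
  rcases lt_trichotomy i k with hik | rfl | hik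
  · rcases lt_trichotomy j k with hjk | rfl | hjk
    · exact h1 i hi j hj k hk hik hjk
    · simp [orientationSign_eq, det3_self_right]
    · rw [orientationSign_swap _ (f k), orientationSign_swap _ (g k),
        h1 i hi k hk j hj (hik.trans hjk) hjk]
  · simp [orientationSign_eq, det3_self_outer]
  · rcases lt_trichotomy i j with hij | rfl | hij
    · rw [orientationSign_swap _ (f k), orientationSign_swap _ (g k),
        h1 i hi k hk j hj hij (hik.trans hij)]
    · simp [orientationSign_eq, det3_self_left]
    · have hF := h1 k hk j hj i hi hik hij
      rw [orientationSign_eq, orientationSign_eq, ← det3_rotate, ← det3_rotate (g i),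
        ← orientationSign_eq, ← orientationSign_eq, orientationSign_swap_left (f k),
        orientationSign_swap_left (g k), hF]

theorem HasSameTypeTransversals.orientedCrossing_of {V : Type*} {K : ℕ} {A : Fin K → Finset Plane}
    {f : V → Plane} {p : V → Fin K} (hp : ∀ v, f v ∈ A (p v)) {a b c d a' b' c' d' : V}
    (hd : p a ≠ p b ∧ p a ≠ p c ∧ p a ≠ p d ∧ p b ≠ p c ∧ p b ≠ p d ∧ p c ≠ p d)
    (h : HasSameTypeTransversals A {p a, p b, p c, p d})
    (ha : p a' = p a) (hb : p b' = p b) (hc : p c' = p c) (hd' : p d' = p d)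
    (hcr : OrientedCrossing f a' b' c' d') : OrientedCrossing f a b c d := by
  obtain ⟨hab, hac, had, hbc, hbd, hcd⟩ := hd
  -- A vertex quadruple becomes a choice function on all parts. Its values away from the four parts
  -- in question are never used.
  let F : (V × V × V × V) → Fin K → Plane := fun v i =>
    if i = p a then f v.1 else if i = p b then f v.2.1 else if i = p c then f v.2.2.1
    else f v.2.2.2
  have Fa : ∀ v, F v (p a) = f v.1 := fun v => by simp [F]
  have Fb : ∀ v, F v (p b) = f v.2.1 := fun v => by simp [F, hab.symm]
  have Fc : ∀ v, F v (p c) = f v.2.2.1 := fun v => by simp [F, hac.symm, hbc.symm]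
  have Fd : ∀ v, F v (p d) = f v.2.2.2 := fun v => by simp [F, had.symm, hbd.symm, hcd.symm]
  have hF : ∀ v : V × V × V × V, p v.1 = p a → p v.2.1 = p b → p v.2.2.1 = p c →
      p v.2.2.2 = p d → ∀ i ∈ ({p a, p b, p c, p d} : Finset (Fin K)), F v i ∈ A i := by
    intro v h1 h2 h3 h4 i hi
    simp only [Finset.mem_insert, Finset.mem_singleton] at hi
    rcases hi with rfl | rfl | rfl | rfl
    · rw [Fa, ← h1]; exact hp _
    · rw [Fb, ← h2]; exact hp _
    · rw [Fc, ← h3]; exact hp _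
    · rw [Fd, ← h4]; exact hp _
  have key := fun i j k hi hj hk => h.orientationSign_congr (i := i) (j := j) (k := k)
    (hF (a', b', c', d') ha hb hc hd') (hF (a, b, c, d) rfl rfl rfl rfl) hi hj hk
  have k1 := key (p a) (p b) (p c) (by simp) (by simp) (by simp)
  have k2 := key (p a) (p b) (p d) (by simp) (by simp) (by simp)
  have k3 := key (p c) (p d) (p a) (by simp) (by simp) (by simp)
  have k4 := key (p c) (p d) (p b) (by simp) (by simp) (by simp)
  simp only [Fa, Fb, Fc, Fd] at k1 k2 k3 k4
  obtain ⟨-, h1, h2⟩ := hcr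
  refine ⟨⟨?_, ?_, ?_, ?_, ?_, ?_⟩, by rwa [← k1, ← k2], by rwa [← k3, ← k4]⟩
  all_goals rintro rfl; simp_all

theorem sum_comp_le {V ι : Type*} [Fintype V] [Fintype ι] [DecidableEq ι] (p : V → ι) {s : ℝ}
    (hs : ∀ i, ((Finset.univ.filter (p · = i)).card : ℝ) ≤ s) (g : ι → ℝ) (hg : ∀ i, 0 ≤ g i) :
    ∑ a, g (p a) ≤ s * ∑ i, g i := by
  rw [← Finset.sum_fiberwise Finset.univ p, Finset.mul_sum]
  refine Finset.sum_le_sum fun i _ => ?_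
  rw [Finset.sum_congr rfl (g := fun _ => g i)
    (fun a ha => by rw [(Finset.mem_filter.1 ha).2]), Finset.sum_const, nsmul_eq_mul]
  exact mul_le_mul_of_nonneg_right (hs i) (hg i)

theorem card_ordered_quadruples_le {ι : Type*} [Fintype ι] [DecidableEq ι]
    (B : Finset (Finset ι)) (hB : ∀ S ∈ B, S.card = 4) :
    (Finset.univ.filter fun t : ι × ι × ι × ι =>
      (t.1 ≠ t.2.1 ∧ t.1 ≠ t.2.2.1 ∧ t.1 ≠ t.2.2.2 ∧ t.2.1 ≠ t.2.2.1 ∧ t.2.1 ≠ t.2.2.2 ∧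
        t.2.2.1 ≠ t.2.2.2) ∧ {t.1, t.2.1, t.2.2.1, t.2.2.2} ∈ B).card ≤ 24 * B.card := by
  refine Finset.card_le_mul_card_image_of_maps_to
    (f := fun t : ι × ι × ι × ι => ({t.1, t.2.1, t.2.2.1, t.2.2.2} : Finset ι))
    (fun t ht => (Finset.mem_filter.1 ht).2.2) 24 fun S hS => ?_
  have hc := hB S hS
  -- Successive choices without repetition from the four elements of `S`, 4·3·2·1 in number.
  let T : Finset (Σ _ : ι, Σ _ : ι, Σ _ : ι, ι) := S.sigma fun i => (S.erase i).sigma fun j =>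
    ((S.erase i).erase j).sigma fun k => ((S.erase i).erase j).erase k
  have hT : T.card = 24 := by
    have h3 : ∀ i ∈ S, ∀ j ∈ S.erase i, ∀ k ∈ (S.erase i).erase j,
        (((S.erase i).erase j).erase k).card = 1 := by
      intro i hi j hj k hk
      rw [Finset.card_erase_of_mem hk, Finset.card_erase_of_mem hj, Finset.card_erase_of_mem hi, hc]
    have h2 : ∀ i ∈ S, ∀ j ∈ S.erase i, (((S.erase i).erase j).sigma fun k =>
        ((S.erase i).erase j).erase k).card = 2 := by
      intro i hi j hj
      rw [Finset.card_sigma, Finset.sum_const_nat (h3 i hi j hj), Finset.card_erase_of_mem hj,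
        Finset.card_erase_of_mem hi, hc]
    have h1 : ∀ i ∈ S, ((S.erase i).sigma fun j => ((S.erase i).erase j).sigma fun k =>
        ((S.erase i).erase j).erase k).card = 6 := by
      intro i hi
      rw [Finset.card_sigma, Finset.sum_const_nat (h2 i hi), Finset.card_erase_of_mem hi, hc]
    rw [Finset.card_sigma, Finset.sum_const_nat h1, hc]
  rw [← hT]
  refine Finset.card_le_card_of_injOn (fun t => ⟨t.1, t.2.1, t.2.2.1, t.2.2.2⟩) ?_ ?_
  · rintro ⟨i, j, k, l⟩ ht
    simp only [Finset.coe_filter, Finset.mem_filter, Finset.mem_univ, true_and,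
      Set.mem_ofPred_eq] at ht
    obtain ⟨⟨⟨h1, h2, h3, h4, h5, h6⟩, -⟩, rfl⟩ := ht
    simp [T, h1.symm, h2.symm, h3.symm, h4.symm, h5.symm, h6.symm]
  · rintro ⟨i, j, k, l⟩ - ⟨i', j', k', l'⟩ - h
    simpa using h

section
open Classical

variable {V : Type*} [Fintype V]

theorem sum_quadruples_of_pairs (r : V → V → ℝ) :
    ∑ x : V × V, ∑ y : V × V, (r x.1 x.2 + r x.1 y.1 + r x.1 y.2 + r x.2 y.1 + r x.2 y.2 +
      r y.1 y.2) = 6 * (Fintype.card V : ℝ) ^ 2 * ∑ a, ∑ b, r a b := by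
  simp only [Fintype.sum_prod_type, Finset.sum_add_distrib, Finset.sum_const, nsmul_eq_mul,
    Finset.card_univ, ← Finset.mul_sum, Fintype.card_prod, Nat.cast_mul]
  rw [Finset.sum_comm (f := fun a b => r a b)]
  ring

theorem sum_quadruples_comp_le {ι : Type*} [Fintype ι] [DecidableEq ι] (p : V → ι) {s : ℝ}
    (hs0 : 0 ≤ s) (hs : ∀ i, ((Finset.univ.filter (p · = i)).card : ℝ) ≤ s)
    (t : ι → ι → ι → ι → ℝ) (ht : ∀ i j k l, 0 ≤ t i j k l) :
    ∑ x : V × V, ∑ y : V × V, t (p x.1) (p x.2) (p y.1) (p y.2) ≤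
      s ^ 4 * ∑ i, ∑ j, ∑ k, ∑ l, t i j k l := by
  simp only [Fintype.sum_prod_type]
  calc _ ≤ ∑ a, ∑ b, ∑ c, s * ∑ l, t (p a) (p b) (p c) l := by
        gcongr; exact sum_comp_le p hs _ fun _ => ht _ _ _ _
    _ ≤ ∑ a, ∑ b, s * (∑ k, s * ∑ l, t (p a) (p b) k l) := by
        gcongr
        exact sum_comp_le p hs (fun k => s * ∑ l, t _ _ k l) fun _ =>
          mul_nonneg hs0 (Finset.sum_nonneg fun _ _ => ht _ _ _ _)
    _ ≤ ∑ a, s * ∑ j, s * (∑ k, s * ∑ l, t (p a) j k l) := by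
        gcongr
        exact sum_comp_le p hs (fun j => s * ∑ k, s * ∑ l, t _ j k l) fun _ =>
          mul_nonneg hs0 (Finset.sum_nonneg fun _ _ =>
            mul_nonneg hs0 (Finset.sum_nonneg fun _ _ => ht _ _ _ _))
    _ ≤ s * ∑ i, s * ∑ j, s * (∑ k, s * ∑ l, t i j k l) :=
        sum_comp_le p hs (fun i => s * ∑ j, s * ∑ k, s * ∑ l, t i j k l) fun _ =>
          mul_nonneg hs0 (Finset.sum_nonneg fun _ _ =>
            mul_nonneg hs0 (Finset.sum_nonneg fun _ _ =>
              mul_nonneg hs0 (Finset.sum_nonneg fun _ _ => ht _ _ _ _)))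
    _ = _ := by simp only [← Finset.mul_sum]; ring

theorem sum_card_eq_of_isEquitablePartition {P : Finset Plane} {K : ℕ} {A : Fin K → Finset Plane}
    (hA : IsEquitablePartition P A) : ∑ i, (A i).card = P.card := by
  rw [← Finset.card_biUnion fun i _ j _ hij => hA.disjoint i j hij]
  congr 1
  ext p
  simp [hA.mem_iff]

theorem card_part_le {P : Finset Plane} {K : ℕ} {A : Fin K → Finset Plane}
    (hA : IsEquitablePartition P A) (i : Fin K) :
    ((A i).card : ℝ) ≤ (P.card : ℝ) / K + 1 := by
  have hK : (0 : ℝ) < K := by exact_mod_cast i.pos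
  have h1 : ∑ _j : Fin K, (A i).card ≤ ∑ j, ((A j).card + 1) :=
    Finset.sum_le_sum fun j _ => hA.card_le i j
  rw [Finset.sum_add_distrib, sum_card_eq_of_isEquitablePartition hA] at h1
  simp only [Finset.sum_const, Finset.card_univ, Fintype.card_fin, smul_eq_mul, mul_one] at h1
  have h2 : (K : ℝ) * (A i).card ≤ P.card + K := by exact_mod_cast h1
  rw [div_add_one hK.ne', le_div_iff₀ hK]
  linarith

/-- The crossing sums of two graphs, compared by means of a same-type partition. -/
theorem abs_orientedCrossingSum_sub_le_of_partition (G G' : EdgeWeightedGraph V) {f : V → Plane}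
    (hf : IsGeneric f) {K : ℕ} (hK : 0 < K) {A : Fin K → Finset Plane}
    (hA : IsEquitablePartition (Finset.univ.image f) A) :
    |orientedCrossingSum G.weight f - orientedCrossingSum G'.weight f| ≤
      2 * G.cutDistance G' * (K : ℝ) ^ 2 * (Fintype.card V : ℝ) ^ 2 +
        (6 * (Fintype.card V : ℝ) ^ 4 / K +
          ((Fintype.card V : ℝ) / K + 1) ^ 4 * (24 * (badQuadruples A).card)) := by
  set n : ℝ := (Fintype.card V : ℝ) with hn
  have hP : ((Finset.univ.image f).card : ℝ) = n := by
    rw [Finset.card_image_of_injective _ hf.injective, hn, Finset.card_univ]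
  have hex : ∀ v, ∃ i, f v ∈ A i := fun v => (hA.mem_iff _).1 (by simp)
  choose p hp using hex
  have hfib : ∀ i, ((Finset.univ.filter (p · = i)).card : ℝ) ≤ n / K + 1 := by
    intro i
    rw [← hP]
    refine le_trans ?_ (card_part_le hA i)
    norm_cast
    refine Finset.card_le_card_of_injOn f (fun v hv => ?_) hf.injective.injOn
    rw [← (Finset.mem_filter.1 hv).2]
    exact hp v
  -- Two pairs of parts are declared crossing when the four parts are distinct, have same-type
  -- transversals, and contain at least one crossing choice of vertices. Same-type transversals then
  -- make every choice cross.
  obtain ⟨Z, hZ⟩ : ∃ Z : Fin K × Fin K → Fin K × Fin K → Prop, ∀ x y, Z x y ↔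
      ((x.1 ≠ x.2 ∧ x.1 ≠ y.1 ∧ x.1 ≠ y.2 ∧ x.2 ≠ y.1 ∧ x.2 ≠ y.2 ∧ y.1 ≠ y.2) ∧
        HasSameTypeTransversals A {x.1, x.2, y.1, y.2}) ∧
        ∃ a b c d, p a = x.1 ∧ p b = x.2 ∧ p c = y.1 ∧ p d = y.2 ∧
          OrientedCrossing f a b c d := ⟨_, fun _ _ => Iff.rfl⟩
  have key := abs_orientedCrossingSum_sub_le G G' f p Z
  rw [Fintype.card_fin] at key
  refine key.trans (add_le_add_right ?_ _)
  -- Excluding `a = b` removes the extra 1 in the bound n/K + 1 on part sizes, so that each row sums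
  -- to at most n/K.
  let r : V → V → ℝ := fun a b => if a ≠ b ∧ p a = p b then 1 else 0
  let t : Fin K → Fin K → Fin K → Fin K → ℝ := fun i j k l =>
    if (i ≠ j ∧ i ≠ k ∧ i ≠ l ∧ j ≠ k ∧ j ≠ l ∧ k ≠ l) ∧ {i, j, k, l} ∈ badQuadruples A
      then 1 else 0
  have hr0 : ∀ a b, 0 ≤ r a b := fun a b => by simp only [r]; split_ifs <;> norm_num
  have ht0 : ∀ i j k l, 0 ≤ t i j k l := fun i j k l => by
    simp only [t]; split_ifs <;> norm_num
  have hpt : ∀ x y : V × V, (if OrientedCrossing f x.1 x.2 y.1 y.2 ↔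
      Z (p x.1, p x.2) (p y.1, p y.2) then (0 : ℝ) else 1) ≤
      (r x.1 x.2 + r x.1 y.1 + r x.1 y.2 + r x.2 y.1 + r x.2 y.2 + r y.1 y.2) +
        t (p x.1) (p x.2) (p y.1) (p y.2) := by
    rintro ⟨a, b⟩ ⟨c, d⟩
    split_ifs with h
    · have := ht0 (p a) (p b) (p c) (p d)
      have := hr0 a b; have := hr0 a c; have := hr0 a d; have := hr0 b c
      have := hr0 b d; have := hr0 c d
      dsimp only; linarith
    · rw [hZ] at h
      dsimp only at h ⊢
      have hT := ht0 (p a) (p b) (p c) (p d)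
      have r1 := hr0 a b; have r2 := hr0 a c; have r3 := hr0 a d; have r4 := hr0 b c
      have r5 := hr0 b d; have r6 := hr0 c d
      by_cases hd : p a ≠ p b ∧ p a ≠ p c ∧ p a ≠ p d ∧ p b ≠ p c ∧ p b ≠ p d ∧ p c ≠ p d
      · have hbad : {p a, p b, p c, p d} ∈ badQuadruples A := by
          simp only [badQuadruples, Finset.mem_filter, Finset.mem_powersetCard,
            Finset.subset_univ, true_and]
          obtain ⟨h1, h2, h3, h4, h5, h6⟩ := hd
          refine ⟨by simp [h1, h2, h3, h4, h5, h6], fun hs => h ⟨fun hc =>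
            ⟨⟨⟨h1, h2, h3, h4, h5, h6⟩, hs⟩, a, b, c, d, rfl, rfl, rfl, rfl, hc⟩, ?_⟩⟩
          rintro ⟨-, a', b', c', d', ha, hb, hc, hd', hcr⟩
          exact hs.orientedCrossing_of hp ⟨h1, h2, h3, h4, h5, h6⟩ ha hb hc hd' hcr
        have : t (p a) (p b) (p c) (p d) = 1 := if_pos ⟨hd, hbad⟩
        linarith
      -- As `Z` is false when parts coincide, a mismatch here is an actual crossing. Its four
      -- vertices are distinct, so some `r` term equals 1.
      · have hc : OrientedCrossing f a b c d := by
          by_contra hc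
          exact h ⟨fun h' => absurd h' hc, fun hz => absurd hz.1.1 hd⟩
        obtain ⟨⟨h1, h2, h3, h4, h5, h6⟩, -⟩ := hc
        have hone : ∀ a b, a ≠ b → p a = p b → r a b = 1 := fun a b h h' => if_pos ⟨h, h'⟩
        by_cases e1 : p a = p b
        · linarith [hone _ _ h1 e1]
        by_cases e2 : p a = p c
        · linarith [hone _ _ h2 e2]
        by_cases e3 : p a = p d
        · linarith [hone _ _ h3 e3]
        by_cases e4 : p b = p c
        · linarith [hone _ _ h4 e4]
        by_cases e5 : p b = p d
        · linarith [hone _ _ h5 e5]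
        by_cases e6 : p c = p d
        · linarith [hone _ _ h6 e6]
        exact absurd ⟨e1, e2, e3, e4, e5, e6⟩ hd
  have hr : ∑ a, ∑ b, r a b ≤ n ^ 2 / K := by
    have : ∀ a, ∑ b, r a b ≤ n / K := by
      intro a
      have h1 := hfib (p a)
      have h2 : ∑ b, r a b = (((Finset.univ.filter (p · = p a)).erase a).card : ℝ) := by
        simp only [r, Finset.sum_boole]
        congr 2
        ext b
        simp [eq_comm]
      rw [h2, Finset.card_erase_of_mem (by simp), Nat.cast_sub (Finset.card_pos.2 ⟨a, by simp⟩)]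
      push_cast
      linarith
    calc _ ≤ ∑ _a : V, n / K := Finset.sum_le_sum fun a _ => this a
      _ = _ := by
        rw [Finset.sum_const, Finset.card_univ, nsmul_eq_mul, ← hn]; ring
  have ht : ∑ i, ∑ j, ∑ k, ∑ l, t i j k l ≤ 24 * (badQuadruples A).card := by
    have := card_ordered_quadruples_le (badQuadruples A) fun S hS => by
      simp only [badQuadruples, Finset.mem_filter, Finset.mem_powersetCard] at hS
      exact hS.1.2
    refine le_trans (le_of_eq ?_) (Nat.cast_le (α := ℝ).2 this |>.trans (by push_cast; rfl))
    rw [← Finset.sum_boole]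
    simp only [Fintype.sum_prod_type, t]
  calc _ ≤ ∑ x : V × V, ∑ y : V × V,
        ((r x.1 x.2 + r x.1 y.1 + r x.1 y.2 + r x.2 y.1 + r x.2 y.2 + r y.1 y.2) +
        t (p x.1) (p x.2) (p y.1) (p y.2)) :=
        Finset.sum_le_sum fun x _ => Finset.sum_le_sum fun y _ => hpt x y
    _ = 6 * n ^ 2 * ∑ a, ∑ b, r a b +
        ∑ x : V × V, ∑ y : V × V, t (p x.1) (p x.2) (p y.1) (p y.2) := by
        rw [← sum_quadruples_of_pairs]
        simp only [Finset.sum_add_distrib]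
    _ ≤ 6 * n ^ 2 * (n ^ 2 / K) + (n / K + 1) ^ 4 * (24 * (badQuadruples A).card) := by
        refine add_le_add (mul_le_mul_of_nonneg_left hr (by positivity)) ?_
        exact (sum_quadruples_comp_le p (by positivity) hfib t ht0).trans
          (mul_le_mul_of_nonneg_left ht (by positivity))
    _ = _ := by ring

end

/-! ### Choice of parameters in the stability bound -/

theorem IsSameTypePartitionConstant.one_lt {C : ℝ} (hC : IsSameTypePartitionConstant C) :
    1 < C := by
  -- The bounds on the number of parts already give 4 < K < 4^C, so the empty point set suffices.
  obtain ⟨K, A, h1, h2, -⟩ := hC (1 / 4) (by norm_num) (by norm_num) ∅ (by simp [InGeneralPosition])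
  have h3 : (4 : ℝ) ^ (1 : ℝ) < 4 ^ C := by
    rw [one_div, Real.inv_rpow (by norm_num), Real.rpow_neg (by norm_num), inv_inv] at h2
    rw [Real.rpow_one]
    have h4 : (4 : ℝ) < K := by norm_num at h1; exact_mod_cast h1
    exact h4.trans h2
  exact (Real.rpow_lt_rpow_left_iff (by norm_num)).1 h3

/-- With every vertex its own class there is no mismatch error. This serves the case where n is too
small compared with K for n/K + 1 to be close to n/K. -/
theorem abs_orientedCrossingSum_sub_le_of_singletons {V : Type*} [Fintype V]
    (G G' : EdgeWeightedGraph V) (f : V → Plane) :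
    |orientedCrossingSum G.weight f - orientedCrossingSum G'.weight f| ≤
      2 * G.cutDistance G' * (Fintype.card V : ℝ) ^ 2 * (Fintype.card V : ℝ) ^ 2 := by
  have := abs_orientedCrossingSum_sub_le G G' f id fun x y => OrientedCrossing f x.1 x.2 y.1 y.2
  simpa using this

theorem IsGeneric.inGeneralPosition_image {V : Type*} [Fintype V] [DecidableEq Plane]
    {f : V → Plane} (hf : IsGeneric f) : InGeneralPosition (Finset.univ.image f) := by
  intro p hp q hq r hr hpq hpr hqr hc
  obtain ⟨u, -, rfl⟩ := Finset.mem_image.1 hp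
  obtain ⟨v, -, rfl⟩ := Finset.mem_image.1 hq
  obtain ⟨w, -, rfl⟩ := Finset.mem_image.1 hr
  exact hf.det3_ne_zero u v w (fun h => hpq (h ▸ rfl)) (fun h => hpr (h ▸ rfl))
    (fun h => hqr (h ▸ rfl)) (det3_eq_zero_of_collinear hc)

theorem twentyfour_mul_choose_le (K : ℕ) : 24 * (K.choose 4 : ℝ) ≤ (K : ℝ) ^ 4 := by
  have h1 := Nat.descFactorial_eq_factorial_mul_choose K 4
  have h2 := Nat.descFactorial_le_pow K 4
  rw [h1] at h2
  have h3 : Nat.factorial 4 = 24 := rfl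
  rw [h3] at h2
  exact_mod_cast h2

/-- Arithmetic relating `ε`, `δ = ε ^ (1 / (4 * C))` and the number of parts for `4 / 5 * δ`. -/
theorem mul_sq_le_of_lt_rpow {C ε δ K : ℝ} (hC : 1 < C) (hε : 0 < ε) (hδ : δ = ε ^ (1 / (4 * C)))
    (hδ1 : δ < 1 / 8) (hK0 : 0 ≤ K) (hK : K < (4 / 5 * δ) ^ (-C)) :
    ε * K ^ 2 ≤ 25 / 16 * δ ^ 2 := by
  have hδ0 : 0 < δ := hδ ▸ Real.rpow_pos_of_pos hε _
  have he : ε = (δ ^ (2 * C)) ^ 2 := by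
    rw [← Real.rpow_natCast, ← Real.rpow_mul hδ0.le, hδ, ← Real.rpow_mul hε.le]
    have : 1 / (4 * C) * (2 * C * (2 : ℕ)) = 1 := by push_cast; field_simp; norm_num
    rw [this, Real.rpow_one]
  have h1 : δ ^ (2 * C) * K ≤ 5 / 4 * δ := by
    calc δ ^ (2 * C) * K ≤ δ ^ (2 * C) * (4 / 5 * δ) ^ (-C) := by gcongr
      _ = (5 / 4 * δ) ^ C := by
        rw [Real.rpow_neg (by positivity), ← Real.inv_rpow (by positivity),
          Real.rpow_mul hδ0.le, ← Real.mul_rpow (by positivity) (by positivity)]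
        congr 1
        rw [Real.rpow_ofNat]
        field_simp
      _ ≤ (5 / 4 * δ) ^ (1 : ℝ) :=
        Real.rpow_le_rpow_of_exponent_ge (by positivity) (by linarith) hC.le
      _ = _ := Real.rpow_one _
  calc ε * K ^ 2 = (δ ^ (2 * C) * K) ^ 2 := by rw [he]; ring
    _ ≤ (5 / 4 * δ) ^ 2 := by gcongr
    _ = _ := by ring

/-- The rectilinear crossing number is stable under small changes in cut-distance. -/
theorem IsSameTypePartitionConstant.abs_rectilinearCrossingNumber_sub_le {C : ℝ}
    (hC : IsSameTypePartitionConstant C) {ε : ℝ} (hε : 0 < ε) {V : Type*} [Fintype V]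
    (G G' : EdgeWeightedGraph V)
    (hd : G.cutDistance G' < ε * (Fintype.card V : ℝ) ^ 2) :
    |G.rectilinearCrossingNumber - G'.rectilinearCrossingNumber|
      ≤ ε ^ (1 / (4 * C)) * (Fintype.card V : ℝ) ^ 4 := by
  classical
  apply EdgeWeightedGraph.abs_rectilinearCrossingNumber_sub_le
  intro f hf
  obtain ⟨δ, hδ⟩ : ∃ δ, δ = ε ^ (1 / (4 * C)) := ⟨_, rfl⟩
  have hδ0 : 0 < δ := hδ ▸ Real.rpow_pos_of_pos hε _
  rw [← hδ]
  obtain ⟨n, hn⟩ : ∃ n : ℝ, n = (Fintype.card V : ℝ) := ⟨_, rfl⟩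
  have hn0 : 0 ≤ n := hn ▸ Nat.cast_nonneg _
  -- For such δ the claim is trivial, both sums lying between 0 and n⁴.
  by_cases hδ1 : 1 / 8 ≤ δ
  · have h1 := orientedCrossingSum_mem_Icc G f
    have h2 := orientedCrossingSum_mem_Icc G' f
    rw [← hn] at h1 h2 ⊢
    have h3 : n ^ 4 ≤ 8 * (δ * n ^ 4) := by nlinarith [pow_nonneg hn0 4]
    rw [abs_le]
    constructor <;> linarith [h1.1, h1.2, h2.1, h2.2]
  push Not at hδ1
  -- The factor 4/5 leaves room for the rounding in part sizes: (5/4)⁴ · 4/5 = 125/64 < 2.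
  obtain ⟨K, A, hK1, hK2, hA, hbad⟩ := hC (4 / 5 * δ) (by positivity) (by linarith)
    (Finset.univ.image f) hf.inGeneralPosition_image
  have hKpos : (0 : ℝ) < K := lt_trans (by positivity) hK1
  have hεK := mul_sq_le_of_lt_rpow hC.one_lt hε hδ hδ1 hKpos.le hK2
  have hεδ : ε * (K : ℝ) ^ 2 ≤ 25 / 16 * (δ / 8) := hεK.trans (by nlinarith)
  rw [← hn] at hd ⊢
  by_cases hnK : n < 4 * K
  · refine (abs_orientedCrossingSum_sub_le_of_singletons G G' f).trans ?_
    rw [← hn]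
    calc 2 * G.cutDistance G' * n ^ 2 * n ^ 2 ≤ 2 * (ε * n ^ 2) * n ^ 2 * n ^ 2 := by gcongr
      _ = 2 * ε * n ^ 2 * n ^ 4 := by ring
      _ ≤ 2 * ε * (4 * K) ^ 2 * n ^ 4 := by gcongr
      _ = 32 * (ε * K ^ 2) * n ^ 4 := by ring
      _ ≤ 32 * (25 / 16 * (δ / 8)) * n ^ 4 := by
        gcongr
      _ ≤ 8 * (δ * n ^ 4) := by nlinarith [mul_nonneg hδ0.le (pow_nonneg hn0 4)]
  · push Not at hnK
    refine (abs_orientedCrossingSum_sub_le_of_partition G G' hf (by exact_mod_cast hKpos)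
      hA).trans ?_
    rw [← hn]
    have h1 : 2 * G.cutDistance G' * (K : ℝ) ^ 2 * n ^ 2 ≤ 25 / 64 * (δ * n ^ 4) := by
      calc 2 * G.cutDistance G' * (K : ℝ) ^ 2 * n ^ 2
          ≤ 2 * (ε * n ^ 2) * (K : ℝ) ^ 2 * n ^ 2 := by gcongr
        _ = 2 * (ε * K ^ 2) * n ^ 4 := by ring
        _ ≤ 2 * (25 / 16 * (δ / 8)) * n ^ 4 := by
          gcongr
        _ = _ := by ring
    have h2 : 6 * n ^ 4 / K ≤ 24 / 5 * (δ * n ^ 4) := by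
      have : 1 / (K : ℝ) ≤ 4 / 5 * δ := by
        rw [div_lt_iff₀ (by positivity)] at hK1
        rw [div_le_iff₀ hKpos]
        linarith
      calc 6 * n ^ 4 / K = 6 * n ^ 4 * (1 / K) := by ring
        _ ≤ 6 * n ^ 4 * (4 / 5 * δ) := by gcongr
        _ = _ := by ring
    have h3 : (n / K + 1) ^ 4 * (24 * (badQuadruples A).card) ≤ 2 * (δ * n ^ 4) := by
      have h4 : n / K + 1 ≤ 5 / 4 * n / K := by
        rw [div_add_one hKpos.ne']
        gcongr
        linarith
      calc (n / K + 1) ^ 4 * (24 * ((badQuadruples A).card : ℝ))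
          ≤ (5 / 4 * n / K) ^ 4 * (24 * (4 / 5 * δ * (K.choose 4 : ℝ))) := by gcongr
        _ = (5 / 4 * n / K) ^ 4 * (4 / 5 * δ) * (24 * (K.choose 4 : ℝ)) := by ring
        _ ≤ (5 / 4 * n / K) ^ 4 * (4 / 5 * δ) * (K : ℝ) ^ 4 := by
          gcongr
          exact twentyfour_mul_choose_le K
        _ = 125 / 64 * (δ * n ^ 4) := by field_simp; ring
        _ ≤ _ := by nlinarith [mul_nonneg hδ0.le (pow_nonneg hn0 4)]
    -- The three contributions add up to 25/64 + 24/5 + 2 < 8.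
    nlinarith [mul_nonneg hδ0.le (pow_nonneg hn0 4)]

/-! ### Inner tangents of finite point sets -/

/-- The linear functional on the plane with coefficients `u`. -/
def lf (u : ℝ × ℝ) (p : Plane) : ℝ := u.1 * p 0 + u.2 * p 1

/-- `X` and `Y` are strictly separated by a line, `X` being on the lower side. -/
def Separated (X Y : Finset Plane) : Prop := ∃ u, ∀ x ∈ X, ∀ y ∈ Y, lf u x < lf u y

/-- The line `lf u = c` meets the convex hull of `Z`. -/
def Stabs (u : ℝ × ℝ) (c : ℝ) (Z : Finset Plane) : Prop :=
  (∃ z ∈ Z, lf u z ≤ c) ∧ ∃ z ∈ Z, c ≤ lf u z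

/-- The line through `a` and `b` meets the convex hull of `Z`. -/
def LineMeets (a b : Plane) (Z : Finset Plane) : Prop :=
  (∃ z ∈ Z, det3 a b z ≤ 0) ∧ ∃ z ∈ Z, 0 ≤ det3 a b z

/-- The line through `a ∈ X` and `b ∈ Y` separates `X` from `Y`; the sign of `s` tells on which side
of the line directed from `a` to `b` the set `X` lies. -/
structure IsInnerTangent (s : ℝ) (X Y : Finset Plane) (a b : Plane) : Prop where
  left_mem : a ∈ X
  right_mem : b ∈ Y
  ne : a ≠ b
  left_nonneg : ∀ x ∈ X, 0 ≤ s * det3 a b x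
  right_nonpos : ∀ y ∈ Y, s * det3 a b y ≤ 0

theorem det3_eq_lf (a b z : Plane) :
    det3 a b z = lf (-(b 1 - a 1), b 0 - a 0) z - lf (-(b 1 - a 1), b 0 - a 0) a := by
  unfold det3 lf; ring

theorem direction_ne_zero {a b : Plane} (h : a ≠ b) : (-(b 1 - a 1), b 0 - a 0) ≠ (0 : ℝ × ℝ) := by
  intro h0
  rw [Prod.mk_eq_zero] at h0
  exact h (plane_ext (by linarith [h0.2]) (by linarith [h0.1]))

theorem lineMeets_iff_stabs (a b : Plane) (Z : Finset Plane) :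
    LineMeets a b Z ↔ Stabs (-(b 1 - a 1), b 0 - a 0) (lf (-(b 1 - a 1), b 0 - a 0) a) Z := by
  simp only [LineMeets, Stabs, det3_eq_lf a b, sub_nonpos, sub_nonneg]

theorem exists_det3_eq_mul {a b a' b' : Plane} (hab : a ≠ b) (ha : det3 a b a' = 0)
    (hb : det3 a b b' = 0) : ∃ r : ℝ, ∀ z, det3 a' b' z = r * det3 a b z := by
  have aux : ∀ c, det3 a b c = 0 → ∃ t : ℝ, c = t • (b - a) + a := by
    intro c hc
    obtain ⟨v, hv⟩ := (collinear_iff_of_mem (p₀ := a) (by simp)).1 (collinear_of_det3_eq_zero hc)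
    obtain ⟨s, hs⟩ := hv b (by simp)
    obtain ⟨t, ht⟩ := hv c (by simp)
    have hs0 : s ≠ 0 := by
      rintro rfl
      exact hab (by simpa using hs.symm)
    refine ⟨t / s, ?_⟩
    rw [ht, hs]
    simp [smul_smul, hs0]
  obtain ⟨t, rfl⟩ := aux _ ha
  obtain ⟨t', rfl⟩ := aux _ hb
  refine ⟨t' - t, fun z => ?_⟩
  simp [det3]; ring

/-- Inner tangents of the same sign lie on one line. After multiplication by `s`, all four terms of
`det3_four` are nonnegative, so they vanish and the four contact points are collinear. -/
theorem IsInnerTangent.lineMeets_of {s : ℝ} (hs : s = 1 ∨ s = -1) {X Y Z : Finset Plane}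
    {a b a' b' : Plane} (h : IsInnerTangent s X Y a b) (h' : IsInnerTangent s X Y a' b')
    (hZ : LineMeets a' b' Z) : LineMeets a b Z := by
  have k1 := h.left_nonneg _ h'.left_mem
  have k2 := h.right_nonpos _ h'.right_mem
  have k3 := h'.left_nonneg _ h.left_mem
  have k4 := h'.right_nonpos _ h.right_mem
  have hid := det3_four a b a' b'
  rw [← det3_rotate a a' b', ← det3_rotate b a' b'] at hid
  have ha : det3 a' b' a = 0 := by rcases hs with rfl | rfl <;> linarith
  have hb : det3 a' b' b = 0 := by rcases hs with rfl | rfl <;> linarith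
  obtain ⟨r, hr⟩ := exists_det3_eq_mul h'.ne ha hb
  obtain ⟨⟨z, hz, hz0⟩, z', hz', hz0'⟩ := hZ
  rcases le_total 0 r with h0 | h0
  · exact ⟨⟨z, hz, by rw [hr]; exact mul_nonpos_of_nonneg_of_nonpos h0 hz0⟩,
      z', hz', by rw [hr]; exact mul_nonneg h0 hz0'⟩
  · exact ⟨⟨z', hz', by rw [hr]; exact mul_nonpos_of_nonpos_of_nonneg h0 hz0'⟩,
      z, hz, by rw [hr]; exact mul_nonneg_of_nonpos_of_nonpos h0 hz0⟩

theorem exists_det3_eq_lf_mul {u : ℝ × ℝ} (hu : u ≠ 0) {a b : Plane} (hab : a ≠ b)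
    (h : lf u a = lf u b) : ∃ r : ℝ, r ≠ 0 ∧ ∀ z, det3 a b z = r * (lf u a - lf u z) := by
  obtain ⟨p, q⟩ := u
  have hpos : 0 < p ^ 2 + q ^ 2 := by
    by_contra hneg
    have hp : p = 0 := by nlinarith [sq_nonneg p, sq_nonneg q]
    have hq : q = 0 := by nlinarith [sq_nonneg p, sq_nonneg q]
    exact hu (by rw [hp, hq]; rfl)
  simp only [lf] at h ⊢
  have e0 : b 0 - a 0 = (-q * (b 0 - a 0) + p * (b 1 - a 1)) / (p ^ 2 + q ^ 2) * -q := by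
    field_simp
    linear_combination -p * h
  have e1 : b 1 - a 1 = (-q * (b 0 - a 0) + p * (b 1 - a 1)) / (p ^ 2 + q ^ 2) * p := by
    field_simp
    linear_combination -q * h
  refine ⟨(-q * (b 0 - a 0) + p * (b 1 - a 1)) / (p ^ 2 + q ^ 2), fun h0 => ?_, fun z => ?_⟩
  · rw [h0, zero_mul] at e0 e1
    exact hab (plane_ext (by linarith) (by linarith))
  · unfold det3
    linear_combination (z 1 - a 1) * e0 - (z 0 - a 0) * e1

/-- The line through `p` and `q` touches their two sets, and it meets the hull of the third because
`r` and `r'` are not strictly on the same side. -/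
theorem exists_stabs_of_sign_ne {A : Fin 3 → Finset Plane} {i j k : Fin 3}
    (hcov : ∀ m, m = i ∨ m = j ∨ m = k) {p q r r' : Plane} (hp : p ∈ A i) (hq : q ∈ A j)
    (hr : r ∈ A k) (hr' : r' ∈ A k) (hpq : p ≠ q)
    (hne : orientationSign p q r ≠ orientationSign p q r') :
    ∃ u : ℝ × ℝ, u ≠ 0 ∧ ∃ c, ∀ m, Stabs u c (A m) := by
  refine ⟨_, direction_ne_zero hpq, _, fun m => (lineMeets_iff_stabs p q _).1 ?_⟩
  have hpp : det3 p q p = 0 := det3_self_outer p q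
  have hqq : det3 p q q = 0 := det3_self_right p q
  rcases hcov m with rfl | rfl | rfl
  · exact ⟨⟨p, hp, hpp.le⟩, p, hp, hpp.ge⟩
  · exact ⟨⟨q, hq, hqq.le⟩, q, hq, hqq.ge⟩
  · rw [orientationSign_eq, orientationSign_eq] at hne
    rcases le_or_gt (det3 p q r) 0 with h1 | h1
    · rcases le_or_gt 0 (det3 p q r') with h2 | h2
      · exact ⟨⟨r, hr, h1⟩, r', hr', h2⟩
      · rcases h1.lt_or_eq with h1 | h1
        · exact absurd (by rw [sign_neg h1, sign_neg h2]) hne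
        · exact ⟨⟨r', hr', h2.le⟩, r, hr, h1.ge⟩
    · rcases le_or_gt (det3 p q r') 0 with h2 | h2
      · exact ⟨⟨r', hr', h2⟩, r, hr, h1.le⟩
      · exact absurd (by rw [sign_pos h1, sign_pos h2]) hne

theorem Separated.ne {X Y : Finset Plane} (h : Separated X Y) {x y : Plane} (hx : x ∈ X)
    (hy : y ∈ Y) : x ≠ y := by
  rintro rfl
  obtain ⟨u, hu⟩ := h
  exact lt_irrefl _ (hu x hx x hy)

theorem orientationSign_rotate (p q r : Plane) :
    orientationSign q r p = orientationSign p q r := by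
  rw [orientationSign_eq, orientationSign_eq, det3_rotate]

/-- Exchanging the points of `f` for those of `g` one at a time, some single exchange changes the
orientation. Separation keeps the two unchanged points distinct. -/
theorem exists_stabs_of_orientationSign_ne {A : Fin 3 → Finset Plane}
    (hsep : ∀ i j, i ≠ j → Separated (A i) (A j)) {f g : Fin 3 → Plane} (hf : ∀ i, f i ∈ A i)
    (hg : ∀ i, g i ∈ A i)
    (hne : orientationSign (f 0) (f 1) (f 2) ≠ orientationSign (g 0) (g 1) (g 2)) :
    ∃ u : ℝ × ℝ, u ≠ 0 ∧ ∃ c, ∀ m, Stabs u c (A m) := by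
  by_cases h1 : orientationSign (f 0) (f 1) (f 2) = orientationSign (f 0) (f 1) (g 2)
  · by_cases h2 : orientationSign (f 0) (f 1) (g 2) = orientationSign (f 0) (g 1) (g 2)
    · have h3 : orientationSign (f 0) (g 1) (g 2) ≠ orientationSign (g 0) (g 1) (g 2) :=
        fun h3 => hne (h1.trans (h2.trans h3))
      rw [← orientationSign_rotate, ← orientationSign_rotate (g 0)] at h3
      exact exists_stabs_of_sign_ne (i := 1) (j := 2) (k := 0) (by decide) (hg 1) (hg 2) (hf 0)
        (hg 0) ((hsep 1 2 (by decide)).ne (hg 1) (hg 2)) h3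
    · rw [orientationSign_rotate (g 2), orientationSign_rotate (g 2)] at h2
      exact exists_stabs_of_sign_ne (i := 2) (j := 0) (k := 1) (by decide) (hg 2) (hf 0) (hf 1)
        (hg 1) ((hsep 2 0 (by decide)).ne (hg 2) (hf 0)) h2
  · exact exists_stabs_of_sign_ne (i := 0) (j := 1) (k := 2) (by decide) (hf 0) (hf 1) (hf 2)
      (hg 2) ((hsep 0 1 (by decide)).ne (hf 0) (hf 1)) h1

theorem continuous_sup'_lf (X : Finset Plane) (hX : X.Nonempty) :
    Continuous fun u => X.sup' hX (lf u) := by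
  refine Continuous.finset_sup'_apply hX fun p _ => ?_
  unfold lf; fun_prop

theorem continuous_inf'_lf (X : Finset Plane) (hX : X.Nonempty) :
    Continuous fun u => X.inf' hX (lf u) := by
  refine Continuous.finset_inf'_apply hX fun p _ => ?_
  unfold lf; fun_prop

/-- If three pairwise separated finite sets have a common line transversal, they have one that is an
inner tangent of two of them. -/
theorem exists_innerTangent_of_stabs {A : Fin 3 → Finset Plane}
    (hsep : ∀ i j, i ≠ j → Separated (A i) (A j)) {u₀ : ℝ × ℝ} (hu₀ : u₀ ≠ 0) {c : ℝ}
    (hst : ∀ m, Stabs u₀ c (A m)) :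
    ∃ i j k, i ≠ j ∧ i ≠ k ∧ j ≠ k ∧ ∃ s : ℝ, (s = 1 ∨ s = -1) ∧
      ∃ a b, IsInnerTangent s (A i) (A j) a b ∧ LineMeets a b (A k) := by
  have hne : ∀ i, (A i).Nonempty := fun i => let ⟨⟨z, hz, _⟩, _⟩ := hst i; ⟨z, hz⟩
  obtain ⟨u₁, hu₁⟩ := hsep 0 1 (by decide)
  let U : ℝ → ℝ × ℝ := fun t => (1 - t) • u₀ + t • u₁
  let S : Finset (Fin 3 × Fin 3) := Finset.univ.filter fun p => p.1 ≠ p.2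
  have hS : S.Nonempty := ⟨(0, 1), by simp [S]⟩
  -- The projections of the three sets have a common point exactly when all these overlaps are
  -- nonnegative. As the normal moves from `u₀` to the separating `u₁`, the smallest overlap passes
  -- through 0, which makes one pair tangent while the third set is still met.
  let h : ℝ → Fin 3 × Fin 3 → ℝ := fun t p =>
    (A p.1).sup' (hne _) (lf (U t)) - (A p.2).inf' (hne _) (lf (U t))
  have hU : Continuous U := by fun_prop
  have hcont : Continuous fun t => S.inf' hS (h t) :=
    Continuous.finset_inf'_apply hS fun p _ =>
      ((continuous_sup'_lf _ (hne p.1)).comp hU).sub ((continuous_inf'_lf _ (hne p.2)).comp hU)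
  have h0 : 0 ≤ S.inf' hS (h 0) := by
    refine Finset.le_inf' _ _ fun p _ => sub_nonneg.2 ?_
    obtain ⟨-, z, hz, hzc⟩ := hst p.1
    obtain ⟨⟨z', hz', hzc'⟩, -⟩ := hst p.2
    have hU0 : U 0 = u₀ := by simp [U]
    rw [hU0]
    exact (Finset.inf'_le _ hz').trans (hzc'.trans (hzc.trans (Finset.le_sup' _ hz)))
  have h1 : S.inf' hS (h 1) ≤ 0 := by
    refine (Finset.inf'_le _ (show ((0, 1) : Fin 3 × Fin 3) ∈ S by simp [S])).trans ?_
    refine sub_nonpos.2 (Finset.sup'_le _ _ fun x hx => Finset.le_inf' _ _ fun y hy => ?_)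
    have hU1 : U 1 = u₁ := by simp [U]
    rw [hU1]
    exact (hu₁ x hx y hy).le
  obtain ⟨t, ⟨ht0, ht1⟩, ht⟩ := intermediate_value_Icc' zero_le_one hcont.continuousOn ⟨h1, h0⟩
  dsimp only at ht
  -- Some `x` in `A 0` and `y` in `A 1` satisfy `lf u₀ x ≤ lf u₀ y` and `lf u₁ x < lf u₁ y`. Hence
  -- no interpolation with positive weight on `u₁` vanishes.
  have hUt : U t ≠ 0 := by
    intro hz
    rcases ht0.eq_or_lt with rfl | ht0
    · exact hu₀ (by simpa [U] using hz)
    obtain ⟨-, y, hy, hyc⟩ := hst 1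
    obtain ⟨⟨x, hx, hxc⟩, -⟩ := hst 0
    have hxy := hu₁ x hx y hy
    have hzx : ∀ p, (1 - t) * lf u₀ p + t * lf u₁ p = 0 := by
      intro p
      have e1 : (1 - t) * u₀.1 + t * u₁.1 = 0 := congrArg Prod.fst hz
      have e2 : (1 - t) * u₀.2 + t * u₁.2 = 0 := congrArg Prod.snd hz
      unfold lf
      linear_combination p 0 * e1 + p 1 * e2
    have := hzx x
    have := hzx y
    nlinarith
  obtain ⟨⟨i, j⟩, hij, hhij⟩ := S.exists_mem_eq_inf' hS (h t)
  have hij' : i ≠ j := by simpa [S] using hij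
  rw [ht] at hhij
  have hall : ∀ i j, i ≠ j → (A j).inf' (hne _) (lf (U t)) ≤ (A i).sup' (hne _) (lf (U t)) := by
    intro i j hij
    have := Finset.inf'_le (h t) (show (i, j) ∈ S by simpa [S] using hij)
    rw [ht] at this
    exact sub_nonneg.1 this
  have hc : (A i).sup' (hne _) (lf (U t)) = (A j).inf' (hne _) (lf (U t)) :=
    (sub_eq_zero.1 hhij.symm)
  obtain ⟨k, hik, hjk⟩ : ∃ k, i ≠ k ∧ j ≠ k :=
    (by decide : ∀ i j : Fin 3, ∃ k, i ≠ k ∧ j ≠ k) i j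
  obtain ⟨a, ha, hca⟩ := (A i).exists_mem_eq_sup' (hne i) (lf (U t))
  obtain ⟨b, hb, hcb⟩ := (A j).exists_mem_eq_inf' (hne j) (lf (U t))
  have hab := (hsep i j hij').ne ha hb
  have hlab : lf (U t) a = lf (U t) b := by rw [← hca, ← hcb, hc]
  obtain ⟨r, hr0, hr⟩ := exists_det3_eq_lf_mul hUt hab hlab
  have hX : ∀ x ∈ A i, 0 ≤ lf (U t) a - lf (U t) x := fun x hx => by
    rw [← hca]; exact sub_nonneg.2 (Finset.le_sup' _ hx)
  have hY : ∀ y ∈ A j, lf (U t) a - lf (U t) y ≤ 0 := fun y hy => by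
    rw [hlab, ← hcb]; exact sub_nonpos.2 (Finset.inf'_le _ hy)
  refine ⟨i, j, k, hij', hik, hjk, ?_⟩
  have hZ : LineMeets a b (A k) := by
    obtain ⟨z, hz, hzs⟩ := (A k).exists_mem_eq_sup' (hne k) (lf (U t))
    obtain ⟨z', hz', hzi⟩ := (A k).exists_mem_eq_inf' (hne k) (lf (U t))
    have e1 : lf (U t) a - lf (U t) z ≤ 0 := by
      rw [← hzs, hlab, ← hcb]; exact sub_nonpos.2 (hall k j hjk.symm)
    have e2 : 0 ≤ lf (U t) a - lf (U t) z' := by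
      rw [← hzi, ← hca]; exact sub_nonneg.2 (hall i k hik)
    rcases le_total 0 r with h | h
    · exact ⟨⟨z, hz, by rw [hr]; exact mul_nonpos_of_nonneg_of_nonpos h e1⟩,
        z', hz', by rw [hr]; exact mul_nonneg h e2⟩
    · exact ⟨⟨z', hz', by rw [hr]; exact mul_nonpos_of_nonpos_of_nonneg h e2⟩,
        z, hz, by rw [hr]; exact mul_nonneg_of_nonpos_of_nonpos h e1⟩
  rcases hr0.lt_or_gt with hneg | hpos
  · refine ⟨-1, Or.inr rfl, a, b, ⟨ha, hb, hab, fun x hx => ?_, fun y hy => ?_⟩, hZ⟩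
    · rw [hr]; nlinarith [mul_nonneg (neg_nonneg.2 hneg.le) (hX x hx)]
    · rw [hr]; nlinarith [mul_nonneg (neg_nonneg.2 hneg.le) (neg_nonneg.2 (hY y hy))]
  · refine ⟨1, Or.inl rfl, a, b, ⟨ha, hb, hab, fun x hx => ?_, fun y hy => ?_⟩, hZ⟩
    · rw [hr]; nlinarith [mul_nonneg hpos.le (hX x hx)]
    · rw [hr]; nlinarith [mul_nonneg hpos.le (neg_nonneg.2 (hY y hy))]

theorem exists_innerTangent_of_orientationSign_ne {A : Fin 3 → Finset Plane}
    (hsep : ∀ i j, i ≠ j → Separated (A i) (A j)) {f g : Fin 3 → Plane} (hf : ∀ i, f i ∈ A i)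
    (hg : ∀ i, g i ∈ A i)
    (hne : orientationSign (f 0) (f 1) (f 2) ≠ orientationSign (g 0) (g 1) (g 2)) :
    ∃ i j k, i ≠ j ∧ i ≠ k ∧ j ≠ k ∧ ∃ s : ℝ, (s = 1 ∨ s = -1) ∧
      ∃ a b, IsInnerTangent s (A i) (A j) a b ∧ LineMeets a b (A k) := by
  obtain ⟨u, hu, c, hst⟩ := exists_stabs_of_orientationSign_ne hsep hf hg hne
  exact exists_innerTangent_of_stabs hsep hu hst

/-! ### Partitions in which every line meets few of the parts -/

theorem card_filter_lf_eq_le {P : Finset Plane} (hP : InGeneralPosition P) {u : ℝ × ℝ}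
    (hu : u ≠ 0) (c : ℝ) : (P.filter fun p => lf u p = c).card ≤ 2 := by
  by_contra! h
  obtain ⟨p, q, r, hp, hq, hr, hpq, hpr, hqr⟩ := Finset.two_lt_card_iff.1 h
  rw [Finset.mem_filter] at hp hq hr
  refine hP p hp.1 q hq.1 r hr.1 hpq hpr hqr (collinear_of_det3_eq_zero ?_)
  obtain ⟨s, -, hs⟩ := exists_det3_eq_lf_mul hu hpq (hp.2.trans hq.2.symm)
  rw [hs, hp.2, hr.2, sub_self, mul_zero]

theorem InGeneralPosition.mono {P Q : Finset Plane} (hP : InGeneralPosition P) (h : Q ⊆ P) :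
    InGeneralPosition Q :=
  fun p hp q hq r hr => hP p (h hp) q (h hq) r (h hr)

/-- The `k`-th smallest value of a linear functional on a finite set of points depends continuously
on the functional. -/
theorem exists_continuous_orderStatistic (S : Finset Plane) {k : ℕ} (hk : 0 < k)
    (hkS : k ≤ S.card) : ∃ M : ℝ × ℝ → ℝ, Continuous M ∧ ∀ u, (∃ p ∈ S, M u = lf u p) ∧
      k ≤ (S.filter fun p => lf u p ≤ M u).card ∧ (S.filter fun p => lf u p < M u).card < k := by
  -- The k-th smallest value is the minimum over k-subsets of their maximum, which is visibly
  -- continuous in `u`. The value 0 on the empty set is never used, since k > 0.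
  let F : Finset Plane → ℝ × ℝ → ℝ := fun T u => if h : T.Nonempty then T.sup' h (lf u) else 0
  have hne : (S.powersetCard k).Nonempty := Finset.powersetCard_nonempty.2 hkS
  have hTne : ∀ T ∈ S.powersetCard k, T.Nonempty := fun T hT => by
    rw [← Finset.card_pos, (Finset.mem_powersetCard.1 hT).2]; exact hk
  have hF : ∀ T (h : T.Nonempty) u, F T u = T.sup' h (lf u) := fun T h u => dif_pos h
  obtain ⟨M, hM⟩ : ∃ M : ℝ × ℝ → ℝ, ∀ u, M u = (S.powersetCard k).inf' hne fun T => F T u :=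
    ⟨_, fun _ => rfl⟩
  refine ⟨M, (Continuous.finset_inf'_apply hne fun T hT => ?_).congr fun u => (hM u).symm,
    fun u => ?_⟩
  · exact (continuous_sup'_lf T (hTne T hT)).congr fun u => (hF T (hTne T hT) u).symm
  · obtain ⟨T, hT, hTM⟩ := (S.powersetCard k).exists_mem_eq_inf' hne fun T => F T u
    have hmin := fun T' (hT' : T' ∈ S.powersetCard k) => Finset.inf'_le (fun T => F T u) hT'
    rw [← hM] at hTM
    simp only [← hM] at hmin
    have hT' := Finset.mem_powersetCard.1 hT
    rw [hF T (hTne T hT)] at hTM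
    refine ⟨?_, ?_, ?_⟩
    · obtain ⟨p, hp, hpe⟩ := T.exists_mem_eq_sup' (hTne T hT) (lf u)
      exact ⟨p, hT'.1 hp, hTM.trans hpe⟩
    · rw [← hT'.2]
      exact Finset.card_le_card fun p hp =>
        Finset.mem_filter.2 ⟨hT'.1 hp, (Finset.le_sup' (lf u) hp).trans hTM.ge⟩
    · by_contra! hcon
      obtain ⟨T', hT's, hT'c⟩ := Finset.exists_subset_card_eq hcon
      have hmem : T' ∈ S.powersetCard k := Finset.mem_powersetCard.2
        ⟨hT's.trans (Finset.filter_subset _ _), hT'c⟩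
      have h1 := hmin T' hmem
      rw [hF T' (hTne T' hmem)] at h1
      refine absurd h1 (not_le.2 ((Finset.sup'_lt_iff _).2 fun p hp => ?_))
      exact (Finset.mem_filter.1 (hT's hp)).2

/-- The discrete ham-sandwich theorem for two sets that are separated by a vertical line. -/
theorem exists_hamSandwich {A B : Finset Plane} (hsep : ∀ a ∈ A, ∀ b ∈ B, a 0 < b 0)
    {k l : ℕ} (hk : 0 < k) (hkA : k ≤ A.card) (hl : 0 < l) (hlB : l ≤ B.card) : ∃ m t : ℝ,
      (k ≤ (A.filter fun p => lf (-m, 1) p ≤ t).card ∧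
        (A.filter fun p => lf (-m, 1) p < t).card < k) ∧
      l ≤ (B.filter fun p => lf (-m, 1) p ≤ t).card ∧
        (B.filter fun p => lf (-m, 1) p < t).card < l := by
  obtain ⟨M, hM, hMp⟩ := exists_continuous_orderStatistic A hk hkA
  obtain ⟨N, hN, hNp⟩ := exists_continuous_orderStatistic B hl hlB
  -- `R` bounds the slopes of all segments from `A` to `B`. At slope -R all values on `A` are at
  -- most those on `B`, at slope R the reverse, so the two order statistics agree at some slope in
  -- between.
  have hbound : ∃ R : ℝ, 0 ≤ R ∧ ∀ a ∈ A, ∀ b ∈ B, |(b 1 - a 1) / (b 0 - a 0)| ≤ R := by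
    refine ⟨∑ x ∈ A ×ˢ B, |(x.2 1 - x.1 1) / (x.2 0 - x.1 0)|,
      Finset.sum_nonneg fun _ _ => abs_nonneg _, fun a ha b hb => ?_⟩
    exact Finset.single_le_sum (f := fun x : Plane × Plane =>
      |(x.2 1 - x.1 1) / (x.2 0 - x.1 0)|) (fun _ _ => abs_nonneg _)
      (show (a, b) ∈ A ×ˢ B from Finset.mem_product.2 ⟨ha, hb⟩)
  obtain ⟨R, hR0, hR⟩ := hbound
  have hkey : ∀ a ∈ A, ∀ b ∈ B, lf (- -R, 1) a ≤ lf (- -R, 1) b ∧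
      lf (-R, 1) b ≤ lf (-R, 1) a := by
    intro a ha b hb
    have hpos := sub_pos.2 (hsep a ha b hb)
    obtain ⟨h1, h2⟩ := abs_le.1 (hR a ha b hb)
    rw [le_div_iff₀ hpos] at h1
    rw [div_le_iff₀ hpos] at h2
    simp only [lf]
    constructor <;> linarith
  let d : ℝ → ℝ := fun m => M (-m, 1) - N (-m, 1)
  have hd : Continuous d := (hM.comp (by fun_prop)).sub (hN.comp (by fun_prop))
  have h1 : d (-R) ≤ 0 := by
    obtain ⟨⟨a, ha, hMa⟩, -⟩ := hMp (- -R, 1)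
    obtain ⟨⟨b, hb, hNb⟩, -⟩ := hNp (- -R, 1)
    exact sub_nonpos.2 (by rw [hMa, hNb]; exact (hkey a ha b hb).1)
  have h2 : 0 ≤ d R := by
    obtain ⟨⟨a, ha, hMa⟩, -⟩ := hMp (-R, 1)
    obtain ⟨⟨b, hb, hNb⟩, -⟩ := hNp (-R, 1)
    exact sub_nonneg.2 (by rw [hMa, hNb]; exact (hkey a ha b hb).2)
  obtain ⟨m, -, hm⟩ := intermediate_value_Icc (by linarith : -R ≤ R) hd.continuousOn ⟨h1, h2⟩
  refine ⟨m, M (-m, 1), (hMp _).2, ?_⟩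
  rw [sub_eq_zero.1 hm]
  exact (hNp _).2

open Classical in
/-- The quadrant of a point with respect to the lines `x = x₀` and `y = m * x + t`. -/
noncomputable def quadrant (x₀ m t : ℝ) (p : Plane) : Bool × Bool :=
  (decide (lf (1, 0) p ≤ x₀), decide (lf (-m, 1) p ≤ t))

/-- General position puts at most two points on the cutting line, so the closed side holds at most k
+ 1 points. -/
theorem card_halves_ge {P : Finset Plane} (hP : InGeneralPosition P) {u : ℝ × ℝ} (hu : u ≠ 0)
    {c : ℝ} {k : ℕ} (h : (P.filter fun p => lf u p < c).card < k) :
    P.card ≤ (P.filter fun p => ¬ lf u p ≤ c).card + k + 1 := by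
  have h1 := Finset.card_filter_add_card_filter_not (s := P) (fun p => lf u p ≤ c)
  have h2 : (P.filter fun p => lf u p ≤ c).card ≤ (P.filter fun p => lf u p < c).card +
      (P.filter fun p => lf u p = c).card := by
    rw [← Finset.card_union_of_disjoint]
    · refine Finset.card_le_card fun p hp => ?_
      simp only [Finset.mem_filter, Finset.mem_union] at hp ⊢
      rcases hp.2.lt_or_eq with h | h <;> tauto
    · exact Finset.disjoint_filter.2 fun p _ h h' => h.ne h'
  have := card_filter_lf_eq_le hP hu c
  omega

/-- A vertical median line is followed by a simultaneous bisection of both sides. Rounding and the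
points on the cutting lines cost each quadrant at most three points. -/
theorem exists_quadrants {P : Finset Plane} (hP : InGeneralPosition P) (hn : 12 ≤ P.card) :
    ∃ x₀ m t : ℝ, ∀ b, P.card ≤ 4 * (P.filter fun p => quadrant x₀ m t p = b).card + 12 := by
  have hu1 : ((1, 0) : ℝ × ℝ) ≠ 0 := by simp
  obtain ⟨M, -, hM⟩ := exists_continuous_orderStatistic P (k := (P.card + 1) / 2)
    (by omega) (by omega)
  obtain ⟨-, hM1, hM2⟩ := hM (1, 0)
  set x₀ := M (1, 0)
  obtain ⟨A, hA⟩ : ∃ A, A = P.filter fun p => lf (1, 0) p ≤ x₀ := ⟨_, rfl⟩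
  obtain ⟨B, hB⟩ : ∃ B, B = P.filter fun p => ¬ lf (1, 0) p ≤ x₀ := ⟨_, rfl⟩
  have hBc := card_halves_ge hP hu1 hM2
  rw [← hA] at hM1
  rw [← hB] at hBc
  have hAP : InGeneralPosition A := hP.mono (hA ▸ Finset.filter_subset _ _)
  have hBP : InGeneralPosition B := hP.mono (hB ▸ Finset.filter_subset _ _)
  have hsep : ∀ a ∈ A, ∀ b ∈ B, a 0 < b 0 := by
    intro a ha b hb
    rw [hA, Finset.mem_filter] at ha
    rw [hB, Finset.mem_filter] at hb
    have h1 := ha.2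
    have h2 := not_le.1 hb.2
    simp only [lf] at h1 h2
    linarith
  obtain ⟨m, t, ⟨ha1, ha2⟩, hb1, hb2⟩ := exists_hamSandwich hsep (k := (A.card + 1) / 2)
    (l := (B.card + 1) / 2) (by omega) (by omega) (by omega) (by omega)
  have hum : ((-m, 1) : ℝ × ℝ) ≠ 0 := by simp
  have ha3 := card_halves_ge hAP hum ha2
  have hb3 := card_halves_ge hBP hum hb2
  rw [hA, Finset.filter_filter] at ha1 ha3
  rw [hB, Finset.filter_filter] at hb1 hb3
  rw [← hA] at ha1 ha3
  rw [← hB] at hb1 hb3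
  refine ⟨x₀, m, t, ?_⟩
  rintro ⟨b1, b2⟩
  cases b1 <;> cases b2 <;> simp only [quadrant, Prod.mk.injEq, decide_eq_true_eq,
    decide_eq_false_iff_not] <;> omega

/-- The witness is a convex combination of two points of `Z` on either side of the line, so it
inherits every closed or open half-plane containing `Z`. -/
theorem exists_mem_line_of_stabs {u : ℝ × ℝ} {c : ℝ} {Z : Finset Plane} (h : Stabs u c Z) :
    ∃ w : Plane, lf u w = c ∧ ∀ v : ℝ × ℝ, ∀ d : ℝ, ((∀ z ∈ Z, lf v z ≤ d) → lf v w ≤ d) ∧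
      ((∀ z ∈ Z, d < lf v z) → d < lf v w) := by
  obtain ⟨⟨z, hz, hzc⟩, z', hz', hzc'⟩ := h
  have hcomb : ∀ (s t : ℝ) (v : ℝ × ℝ), lf v (s • z + t • z') = s * lf v z + t * lf v z' := by
    intro s t v
    simp [lf]; ring
  obtain ⟨s, t, hs, ht, hst, hw⟩ : ∃ s t : ℝ, 0 ≤ s ∧ 0 ≤ t ∧ s + t = 1 ∧
      s * lf u z + t * lf u z' = c := by
    have : c ∈ segment ℝ (lf u z) (lf u z') := by
      rw [segment_eq_Icc (hzc.trans hzc')]; exact ⟨hzc, hzc'⟩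
    obtain ⟨s, t, hs, ht, hst, h⟩ := this
    exact ⟨s, t, hs, ht, hst, h⟩
  refine ⟨s • z + t • z', by rw [hcomb, hw], fun v d => ?_⟩
  have hd : d = s * d + t * d := by rw [← add_mul, hst, one_mul]
  refine ⟨fun h => ?_, fun h => ?_⟩
  · rw [hcomb]
    nlinarith [mul_le_mul_of_nonneg_left (h z hz) hs, mul_le_mul_of_nonneg_left (h z' hz') ht]
  · rw [hcomb]
    have h1 := h z hz
    have h2 := h z' hz'
    rcases hs.eq_or_lt with rfl | hs
    · obtain rfl : t = 1 := by linarith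
      linarith
    · nlinarith [mul_lt_mul_of_pos_left h1 hs, mul_le_mul_of_nonneg_left h2.le ht]

theorem exists_lf_eq_add_mul {u : ℝ × ℝ} (hu : u ≠ 0) {a b : Plane} (h : lf u a = lf u b) :
    ∃ s : ℝ, ∀ v : ℝ × ℝ, lf v b = lf v a + s * (v.2 * u.1 - v.1 * u.2) := by
  obtain ⟨p, q⟩ := u
  have hpos : 0 < p ^ 2 + q ^ 2 := by
    by_contra hneg
    have hp : p = 0 := by nlinarith [sq_nonneg p, sq_nonneg q]
    have hq : q = 0 := by nlinarith [sq_nonneg p, sq_nonneg q]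
    exact hu (by rw [hp, hq]; rfl)
  refine ⟨(-q * (b 0 - a 0) + p * (b 1 - a 1)) / (p ^ 2 + q ^ 2), fun v => ?_⟩
  simp only [lf] at h ⊢
  field_simp
  linear_combination (-v.1 * p - v.2 * q) * h

/-- A line misses one of the four quadrants determined by two lines. -/
theorem exists_quadrant_not_stabs (P : Finset Plane) (x₀ m t : ℝ) {u : ℝ × ℝ} (hu : u ≠ 0)
    (c : ℝ) : ∃ b, ¬ Stabs u c (P.filter fun p => quadrant x₀ m t p = b) := by
  by_contra! hall
  choose w hw hwv using fun b => exists_mem_line_of_stabs (hall b)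
  have h1 : ∀ b2, lf (1, 0) (w (true, b2)) ≤ x₀ := fun b2 =>
    (hwv (true, b2) (1, 0) x₀).1 fun z hz => by
      have := (Prod.mk.inj (Finset.mem_filter.1 hz).2).1
      simpa using this
  have h2 : ∀ b2, x₀ < lf (1, 0) (w (false, b2)) := fun b2 =>
    (hwv (false, b2) (1, 0) x₀).2 fun z hz => by
      have := (Prod.mk.inj (Finset.mem_filter.1 hz).2).1
      simpa using this
  have h3 : ∀ b1, lf (-m, 1) (w (b1, true)) ≤ t := fun b1 =>
    (hwv (b1, true) (-m, 1) t).1 fun z hz => by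
      have := (Prod.mk.inj (Finset.mem_filter.1 hz).2).2
      simpa using this
  have h4 : ∀ b1, t < lf (-m, 1) (w (b1, false)) := fun b1 =>
    (hwv (b1, false) (-m, 1) t).2 fun z hz => by
      have := (Prod.mk.inj (Finset.mem_filter.1 hz).2).2
      simpa using this
  choose s hs using fun b => exists_lf_eq_add_mul hu ((hw (true, true)).trans (hw b).symm)
  have e1 := hs (true, false)
  have e2 := hs (false, true)
  have e3 := hs (false, false)
  obtain ⟨α, hα⟩ : ∃ α, α = ((1, 0) : ℝ × ℝ).2 * u.1 - ((1, 0) : ℝ × ℝ).1 * u.2 := ⟨_, rfl⟩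
  obtain ⟨β, hβ⟩ : ∃ β, β = ((-m, 1) : ℝ × ℝ).2 * u.1 - ((-m, 1) : ℝ × ℝ).1 * u.2 := ⟨_, rfl⟩
  have a1 := e1 (1, 0)
  have a2 := e2 (1, 0)
  have a3 := e3 (1, 0)
  have b1 := e1 (-m, 1)
  have b2 := e2 (-m, 1)
  have b3 := e3 (-m, 1)
  rw [← hα] at a1 a2 a3
  rw [← hβ] at b1 b2 b3
  have p1 := h1 true
  have p2 := h1 false
  have p3 := h2 true
  have p4 := h2 false
  have q1 := h3 true
  have q2 := h3 false
  have q3 := h4 true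
  have q4 := h4 false
  -- `α` and `β` are the rates of the two functionals along the line. One pair of opposite quadrants
  -- requires them to have opposite signs, the other pair equal signs.
  have r1 : 0 < (s (false, true) - s (true, false)) * α := by linarith
  have r2 : (s (false, true) - s (true, false)) * β < 0 := by linarith
  have r3 : 0 < s (false, false) * α := by linarith
  have r4 : 0 < s (false, false) * β := by linarith
  rcases lt_trichotomy α 0 with h | h | h
  · have k1 : s (false, true) - s (true, false) < 0 := by
      by_contra hc; push Not at hc; nlinarith
    have k2 : s (false, false) < 0 := by by_contra hc; push Not at hc; nlinarith
    have k3 : 0 < β := by by_contra hc; push Not at hc; nlinarith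
    have k4 : β < 0 := by by_contra hc; push Not at hc; nlinarith
    linarith
  · rw [h, mul_zero] at r1
    exact lt_irrefl _ r1
  · have k1 : 0 < s (false, true) - s (true, false) := by
      by_contra hc; push Not at hc; nlinarith
    have k2 : 0 < s (false, false) := by by_contra hc; push Not at hc; nlinarith
    have k3 : 0 < β := by by_contra hc; push Not at hc; nlinarith
    have k4 : β < 0 := by by_contra hc; push Not at hc; nlinarith
    linarith

theorem Separated.neg {X Y : Finset Plane} (h : Separated X Y) : Separated Y X := by
  obtain ⟨u, hu⟩ := h
  refine ⟨-u, fun y hy x hx => ?_⟩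
  have := hu x hx y hy
  simp only [lf, Prod.fst_neg, Prod.snd_neg] at this ⊢
  linarith

theorem separated_of_quadrant_ne {X Y : Finset Plane} {x₀ m t : ℝ} {b b' : Bool × Bool}
    (hX : ∀ x ∈ X, quadrant x₀ m t x = b) (hY : ∀ y ∈ Y, quadrant x₀ m t y = b') (h : b ≠ b') :
    Separated X Y := by
  have aux : ∀ {X Y : Finset Plane} {u : ℝ × ℝ} {c : ℝ}, (∀ x ∈ X, lf u x ≤ c) →
      (∀ y ∈ Y, ¬ lf u y ≤ c) → Separated X Y := fun hX hY =>
    ⟨_, fun x hx y hy => (hX x hx).trans_lt (not_le.1 (hY y hy))⟩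
  obtain ⟨b1, b2⟩ := b
  obtain ⟨c1, c2⟩ := b'
  simp only [quadrant, Prod.mk.injEq] at hX hY
  by_cases h1 : b1 = c1
  · have h2 : b2 ≠ c2 := fun h2 => h (by rw [h1, h2])
    cases b2 <;> cases c2 <;> simp only [decide_eq_true_eq, decide_eq_false_iff_not] at hX hY
    · exact absurd rfl h2
    · exact (aux (fun y hy => (hY y hy).2) fun x hx => (hX x hx).2).neg
    · exact aux (fun x hx => (hX x hx).2) fun y hy => (hY y hy).2
    · exact absurd rfl h2
  · cases b1 <;> cases c1 <;> simp only [decide_eq_true_eq, decide_eq_false_iff_not] at hX hY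
    · exact absurd rfl h1
    · exact (aux (fun y hy => (hY y hy).1) fun x hx => (hX x hx).1).neg
    · exact aux (fun x hx => (hX x hx).1) fun y hy => (hY y hy).1
    · exact absurd rfl h1

/-- A finite set in general position can be split into `4 ^ k` pairwise separated classes so that
each line meets only classes of small total size. -/
theorem exists_labelling_stabs_le (k : ℕ) : ∀ P : Finset Plane, InGeneralPosition P →
    ∃ l : Plane → (Fin k → Bool × Bool),
      (∀ i j, i ≠ j → Separated (P.filter (l · = i)) (P.filter (l · = j))) ∧
      ∀ u : ℝ × ℝ, u ≠ 0 → ∀ c (S : Finset Plane),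
        (∀ p ∈ S, p ∈ P ∧ Stabs u c (P.filter (l · = l p))) →
          (S.card : ℝ) ≤ (3 / 4) ^ k * P.card + 16 * 4 ^ k := by
  induction k with
  | zero =>
    intro P hP
    refine ⟨fun _ => Fin.elim0, fun i j hij => absurd (Subsingleton.elim i j) hij,
      fun u _ c S hS => ?_⟩
    have : (S.card : ℝ) ≤ P.card := by
      exact_mod_cast Finset.card_le_card fun p hp => (hS p hp).1
    simpa using this.trans (by linarith)
  | succ k ih =>
    intro P hP
    -- Small sets need no cutting, as the additive error term already exceeds their size.
    by_cases hn : P.card < 12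
    · refine ⟨fun _ _ => (true, true), fun i j hij => ?_, fun u _ c S hS => ?_⟩
      · by_cases hi : (fun _ => (true, true)) = i
        · refine ⟨0, fun x _ y hy => ?_⟩
          exact absurd (hi.symm.trans (Finset.mem_filter.1 hy).2) hij
        · refine ⟨0, fun x hx => ?_⟩
          exact absurd (Finset.mem_filter.1 hx).2 hi
      · have h1 : (S.card : ℝ) ≤ P.card := by
          exact_mod_cast Finset.card_le_card fun p hp => (hS p hp).1
        have h2 : (P.card : ℝ) < 12 := by exact_mod_cast hn
        have h3 : (1 : ℝ) ≤ 4 ^ (k + 1) := one_le_pow₀ (by norm_num)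
        have h4 : (0 : ℝ) ≤ (3 / 4) ^ (k + 1) * P.card := by positivity
        linarith
    push Not at hn
    obtain ⟨x₀, m, t, hq⟩ := exists_quadrants hP hn
    let Q : Bool × Bool → Finset Plane := fun b => P.filter fun p => quadrant x₀ m t p = b
    choose l hl1 hl2 using fun b => ih (Q b) (hP.mono (Finset.filter_subset _ _))
    let L : Plane → (Fin (k + 1) → Bool × Bool) := fun p =>
      Fin.cons (quadrant x₀ m t p) (l (quadrant x₀ m t p) p)
    have hL : ∀ i, P.filter (L · = i) = (Q (i 0)).filter (l (i 0) · = Fin.tail i) := by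
      intro i
      ext p
      simp only [L, Q, Finset.mem_filter, and_assoc]
      refine and_congr_right fun _ => ?_
      rw [← Fin.cons_self_tail i, Fin.cons_inj, Fin.cons_zero, Fin.tail_cons]
      constructor
      · rintro ⟨h1, h2⟩
        exact ⟨h1, by rw [← h1]; exact h2⟩
      · rintro ⟨h1, h2⟩
        exact ⟨h1, by rw [h1]; exact h2⟩
    refine ⟨L, fun i j hij => ?_, fun u hu c S hS => ?_⟩
    · rw [hL, hL]
      by_cases h0 : i 0 = j 0
      · rw [h0]
        refine hl1 _ _ _ fun ht => hij ?_
        rw [← Fin.cons_self_tail i, ← Fin.cons_self_tail j, h0, ht]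
      · exact separated_of_quadrant_ne
          (fun x hx => (Finset.mem_filter.1 (Finset.mem_filter.1 hx).1).2)
          (fun x hx => (Finset.mem_filter.1 (Finset.mem_filter.1 hx).1).2) h0
    · obtain ⟨b₀, hb₀⟩ := exists_quadrant_not_stabs P x₀ m t hu c
      have hSb : ∀ b, ((S.filter fun p => quadrant x₀ m t p = b).card : ℝ) ≤
          (3 / 4) ^ k * (Q b).card + 16 * 4 ^ k := by
        intro b
        refine hl2 b u hu c _ fun p hp => ?_
        rw [Finset.mem_filter] at hp
        obtain ⟨hpS, rfl⟩ := hp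
        obtain ⟨hpP, hst⟩ := hS p hpS
        rw [hL] at hst
        exact ⟨Finset.mem_filter.2 ⟨hpP, rfl⟩, hst⟩
      have hS0 : (S.filter fun p => quadrant x₀ m t p = b₀).card = 0 := by
        rw [Finset.card_eq_zero, Finset.filter_eq_empty_iff]
        rintro p hp rfl
        obtain ⟨hpP, ⟨z, hz, hzc⟩, z', hz', hzc'⟩ := hS p hp
        rw [hL] at hz hz'
        exact hb₀ ⟨⟨z, (Finset.mem_filter.1 hz).1, hzc⟩, z', (Finset.mem_filter.1 hz').1, hzc'⟩
      have hsum : ∀ T : Finset Plane, (T.card : ℝ) =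
          ((T.filter fun p => quadrant x₀ m t p = b₀).card : ℝ) + ∑ b ∈ Finset.univ.erase b₀,
            ((T.filter fun p => quadrant x₀ m t p = b).card : ℝ) := by
        intro T
        rw [Finset.add_sum_erase _ (fun b => ((T.filter fun p =>
          quadrant x₀ m t p = b).card : ℝ)) (Finset.mem_univ b₀)]
        exact_mod_cast Finset.card_eq_sum_card_fiberwise fun p _ => Finset.mem_univ _
      have hScard := hsum S
      rw [hS0, Nat.cast_zero, zero_add] at hScard
      have hPcard : (P.card : ℝ) = (Q b₀).card + ∑ b ∈ Finset.univ.erase b₀, ((Q b).card : ℝ) :=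
        hsum P
      have hq0 : (P.card : ℝ) ≤ 4 * (Q b₀).card + 12 := by exact_mod_cast hq b₀
      have hcard3 : (Finset.univ.erase b₀).card = 3 := by
        rw [Finset.card_erase_of_mem (Finset.mem_univ _)]; rfl
      have h34 : ((3 : ℝ) / 4) ^ k ≤ 1 := pow_le_one₀ (by norm_num) (by norm_num)
      have h4 : (1 : ℝ) ≤ 4 ^ k := one_le_pow₀ (by norm_num)
      calc (S.card : ℝ) ≤ ∑ b ∈ Finset.univ.erase b₀, ((3 / 4) ^ k * ((Q b).card : ℝ) +
            16 * 4 ^ k) := by rw [hScard]; exact Finset.sum_le_sum fun b _ => hSb b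
        _ = (3 / 4) ^ k * (P.card - (Q b₀).card) + 48 * 4 ^ k := by
          rw [Finset.sum_add_distrib, ← Finset.mul_sum, Finset.sum_const, hcard3, hPcard]
          simp; ring
        _ ≤ (3 / 4) ^ k * (3 / 4 * P.card + 3) + 48 * 4 ^ k := by
          gcongr
          linarith
        -- The additive error closes up since 3·16·4^k + 3·(3/4)^k ≤ 16·4^(k+1).
        _ ≤ _ := by
          rw [pow_succ, pow_succ]
          nlinarith

/-! ### Existence of same-type partitions -/

/-- `Finpartition.equitabilise` fills each class with parts contained in it, up to at most `P.card /
K` points. The set `N` collects these leftovers, so a part with a point outside `N` lies in a single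
class. -/
theorem exists_equitable_refinement {ι : Type*} [Fintype ι] [DecidableEq ι] (P : Finset Plane)
    (l : Plane → ι) {K : ℕ} (hK : 0 < K) (hKP : K ≤ P.card) :
    ∃ A : Fin K → Finset Plane, IsEquitablePartition P A ∧ (∀ i, P.card / K ≤ (A i).card) ∧
      ∃ N : Finset Plane, N.card ≤ Fintype.card ι * (P.card / K) ∧
        ∀ i, ∀ p ∈ A i, p ∉ N → ∀ q ∈ A i, l q = l p := by
  classical
  obtain ⟨m, hm⟩ : ∃ m, m = P.card / K := ⟨_, rfl⟩
  have hm0 : m ≠ 0 := hm ▸ (Nat.div_pos hKP hK).ne'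
  have hcard : (K - P.card % K) * m + P.card % K * (m + 1) = P.card := by
    have h1 := Nat.mod_lt P.card hK
    have h2 := Nat.mod_add_div P.card K
    rw [← hm] at h2
    generalize P.card % K = b at h1 h2 ⊢
    obtain ⟨d, rfl⟩ := Nat.exists_eq_add_of_le h1.le
    rw [Nat.add_sub_cancel_left, ← h2]
    ring
  let cls : ι → Finset Plane := fun i => P.filter (l · = i)
  let R : Finpartition P := Finpartition.ofErase (Finset.univ.image cls)
    (by
      rw [Finset.supIndep_iff_pairwiseDisjoint]
      intro s hs t ht hst
      obtain ⟨i, -, rfl⟩ := Finset.mem_image.1 (Finset.mem_coe.1 hs)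
      obtain ⟨j, -, rfl⟩ := Finset.mem_image.1 (Finset.mem_coe.1 ht)
      refine Finset.disjoint_left.2 fun p hp hq => hst ?_
      rw [← (Finset.mem_filter.1 hp).2.symm.trans (Finset.mem_filter.1 hq).2])
    (by
      ext p
      simp [Finset.mem_sup, cls])
  have hRcard : R.parts.card ≤ Fintype.card ι :=
    (Finset.card_le_card (Finset.erase_subset _ _)).trans Finset.card_image_le
  have hRmem : ∀ p ∈ P, cls (l p) ∈ R.parts := by
    intro p hp
    refine Finset.mem_erase.2 ⟨?_, Finset.mem_image_of_mem _ (Finset.mem_univ _)⟩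
    exact Finset.nonempty_iff_ne_empty.1 ⟨p, Finset.mem_filter.2 ⟨hp, rfl⟩⟩
  obtain ⟨Q, hQ⟩ : ∃ Q, Q = R.equitabilise hcard := ⟨_, rfl⟩
  have hQcard : Q.parts.card = K := by
    rw [hQ, R.card_parts_equitabilise _ hm0, Nat.sub_add_cancel (Nat.mod_lt _ hK).le]
  have hQsize : ∀ u ∈ Q.parts, u.card = m ∨ u.card = m + 1 := by
    intro u hu
    rw [hQ] at hu
    exact Finpartition.card_eq_of_mem_parts_equitabilise hu
  let e : Fin K ≃ Q.parts := (Finset.equivFinOfCardEq hQcard).symm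
  have hsize := fun i => hQsize _ (e i).2
  have hdisj : ∀ u ∈ Q.parts, ∀ v ∈ Q.parts, ∀ p ∈ u, p ∈ v → u = v := by
    intro u hu v hv p hpu hpv
    by_contra hne
    exact Finset.disjoint_left.1 (Q.disjoint hu hv hne) hpu hpv
  refine ⟨fun i => (e i).1, ⟨fun i j hij => ?_, fun p => ?_, fun i j => ?_⟩, fun i => ?_,
    R.parts.biUnion fun t => t \ {u ∈ Q.parts | u ⊆ t}.biUnion id, ?_, ?_⟩
  · exact Q.disjoint (e i).2 (e j).2 fun h => hij (e.injective (Subtype.ext h))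
  · constructor
    · intro hp
      obtain ⟨u, hu, hpu⟩ := Q.exists_mem hp
      exact ⟨e.symm ⟨u, hu⟩, by simpa using hpu⟩
    · rintro ⟨i, hi⟩
      exact Q.le (e i).2 hi
  · rcases hsize i with h | h <;> rcases hsize j with h' | h' <;> omega
  · dsimp only
    rw [← hm]
    rcases hsize i with h | h <;> omega
  · refine Finset.card_biUnion_le.trans ?_
    rw [← hm]
    refine le_trans (Finset.sum_le_card_nsmul _ _ m fun t ht => ?_) ?_
    · rw [hQ]
      exact R.card_parts_equitabilise_subset_le hcard ht
    · exact Nat.mul_le_mul_right _ hRcard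
  · intro i p hp hpN q hq
    change q ∈ (e i).1 at hq
    have hpP : p ∈ P := Q.le (e i).2 hp
    have hpc : p ∈ cls (l p) := Finset.mem_filter.2 ⟨hpP, rfl⟩
    have h1 : p ∈ {u ∈ Q.parts | u ⊆ cls (l p)}.biUnion id := by
      by_contra hcon
      exact hpN (Finset.mem_biUnion.2 ⟨_, hRmem p hpP, Finset.mem_sdiff.2 ⟨hpc, hcon⟩⟩)
    obtain ⟨u, hu, hpu⟩ := Finset.mem_biUnion.1 h1
    obtain ⟨hu1, hu2⟩ := Finset.mem_filter.1 hu
    rw [hdisj _ (e i).2 u hu1 p hp hpu] at hq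
    exact (Finset.mem_filter.1 (hu2 hq)).2

/-! ### Counting bad triples and bad quadruples of parts -/

section
open Classical

/-- The triples of parts whose transversals do not all have the same orientation. -/
noncomputable def badTriples {K : ℕ} (A : Fin K → Finset Plane) :
    Finset (Fin K × Fin K × Fin K) :=
  Finset.univ.filter fun t => t.1 < t.2.1 ∧ t.2.1 < t.2.2 ∧ ∃ f g : Fin 3 → Plane,
    (∀ i, f i ∈ A (![t.1, t.2.1, t.2.2] i)) ∧ (∀ i, g i ∈ A (![t.1, t.2.1, t.2.2] i)) ∧
      orientationSign (f 0) (f 1) (f 2) ≠ orientationSign (g 0) (g 1) (g 2)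

/-- Failure of the same-type property is witnessed by three parts, and the fourth can be chosen in
at most K ways. -/
theorem card_badQuadruples_le {K : ℕ} (A : Fin K → Finset Plane) :
    (badQuadruples A).card ≤ (badTriples A).card * K := by
  calc (badQuadruples A).card ≤ (((badTriples A) ×ˢ (Finset.univ : Finset (Fin K))).image fun t =>
        ({t.1.1, t.1.2.1, t.1.2.2, t.2} : Finset (Fin K))).card := by
        refine Finset.card_le_card fun s hs => ?_
        simp only [badQuadruples, Finset.mem_filter, Finset.mem_powersetCard, Finset.subset_univ,
          true_and] at hs
        obtain ⟨hc, hs⟩ := hs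
        unfold HasSameTypeTransversals at hs
        push Not at hs
        obtain ⟨f, g, hf, hg, i, hi, j, hj, k, hk, hij, hjk, hne⟩ := hs
        have hsub : ({i, j, k} : Finset (Fin K)) ⊆ s := by
          simp [Finset.insert_subset_iff, hi, hj, hk]
        have hc3 : ({i, j, k} : Finset (Fin K)).card = 3 := by
          rw [Finset.card_eq_three]
          exact ⟨i, j, k, hij.ne, (hij.trans hjk).ne, hjk.ne, rfl⟩
        have hc1 : (s \ {i, j, k}).card = 1 := by
          rw [Finset.card_sdiff_of_subset hsub, hc, hc3]
        obtain ⟨l, hl⟩ := Finset.card_eq_one.1 hc1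
        refine Finset.mem_image.2 ⟨((i, j, k), l), Finset.mem_product.2 ⟨?_, Finset.mem_univ _⟩, ?_⟩
        · refine Finset.mem_filter.2 ⟨Finset.mem_univ _, hij, hjk, fun a => f (![i, j, k] a),
            fun a => g (![i, j, k] a), fun a => hf _ ?_, fun a => hg _ ?_, hne⟩
          all_goals fin_cases a <;> simp [hi, hj, hk]
        · rw [← Finset.union_sdiff_of_subset hsub, hl]
          ext x; simp
    _ ≤ _ := Finset.card_image_le.trans (by simp)

theorem sum_symmetrized_le (P : Finset Plane) (r : Plane → Plane → Plane → ℝ) {D : ℝ}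
    (h : ∀ x ∈ P, ∀ y ∈ P, ∑ z ∈ P, r x y z ≤ D) :
    ∑ x ∈ P, ∑ y ∈ P, ∑ z ∈ P, (r x y z + r x z y + r y x z + r y z x + r z x y + r z y x) ≤
      6 * (P.card : ℝ) ^ 2 * D := by
  have hS : ∑ x ∈ P, ∑ y ∈ P, ∑ z ∈ P, r x y z ≤ (P.card : ℝ) ^ 2 * D := by
    calc _ ≤ ∑ x ∈ P, ∑ y ∈ P, D :=
          Finset.sum_le_sum fun x hx => Finset.sum_le_sum fun y hy => h x hx y hy
      _ = _ := by simp; ring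
  have inner : ∀ g : Plane → Plane → Plane → ℝ, ∑ x ∈ P, ∑ y ∈ P, ∑ z ∈ P, g x z y =
      ∑ x ∈ P, ∑ y ∈ P, ∑ z ∈ P, g x y z := fun g =>
    Finset.sum_congr rfl fun x _ => Finset.sum_comm
  have outer : ∀ g : Plane → Plane → Plane → ℝ, ∑ x ∈ P, ∑ y ∈ P, ∑ z ∈ P, g y x z =
      ∑ x ∈ P, ∑ y ∈ P, ∑ z ∈ P, g x y z := fun g => Finset.sum_comm
  simp only [Finset.sum_add_distrib]
  have e2 := inner r
  have e3 := outer r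
  have e4 := outer fun a b c => r a c b
  have e5 := inner fun a b c => r b a c
  have e6 := inner fun a b c => r b c a
  have e7 := outer fun a b c => r a c b
  linarith

/-- A line through one point of a class meets that class, so the bound for lines also bounds class
sizes. -/
theorem card_labelled_le {P : Finset Plane} {ι : Type*} [DecidableEq ι] {l : Plane → ι} {D : ℝ}
    (hst : ∀ u : ℝ × ℝ, u ≠ 0 → ∀ c (S : Finset Plane),
      (∀ p ∈ S, p ∈ P ∧ Stabs u c (P.filter (l · = l p))) → (S.card : ℝ) ≤ D) (i : ι) :
    ((P.filter (l · = i)).card : ℝ) ≤ D := by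
  rcases (P.filter (l · = i)).eq_empty_or_nonempty with h | ⟨x, hx⟩
  · rw [h, Finset.card_empty, Nat.cast_zero]
    simpa using hst (1, 0) (by simp) 0 ∅ (by simp)
  · refine hst (1, 0) (by simp) (lf (1, 0) x) _ fun p hp => ?_
    obtain ⟨hpP, rfl⟩ := Finset.mem_filter.1 hp
    exact ⟨hpP, ⟨x, hx, le_rfl⟩, x, hx, le_rfl⟩

/-- The class of `z` meets an inner tangent of the classes of `x` and `y`. -/
def MeetsTangent {ι : Type*} [DecidableEq ι] (P : Finset Plane) (l : Plane → ι) (x y z : Plane) (s : ℝ) : Prop :=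
  ∃ a b, IsInnerTangent s (P.filter (l · = l x)) (P.filter (l · = l y)) a b ∧
    LineMeets a b (P.filter (l · = l z))

/-- All inner tangents of sign `s` are the same line, so a single application of the bound for lines
suffices. -/
theorem card_meetsTangent_le {P : Finset Plane} {ι : Type*} [DecidableEq ι] {l : Plane → ι} {D : ℝ}
    (hst : ∀ u : ℝ × ℝ, u ≠ 0 → ∀ c (S : Finset Plane),
      (∀ p ∈ S, p ∈ P ∧ Stabs u c (P.filter (l · = l p))) → (S.card : ℝ) ≤ D) (x y : Plane)
    {s : ℝ} (hs : s = 1 ∨ s = -1) :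
    ((P.filter fun z => MeetsTangent P l x y z s).card : ℝ) ≤ D := by
  by_cases hex : ∃ a b, IsInnerTangent s (P.filter (l · = l x)) (P.filter (l · = l y)) a b
  · obtain ⟨a, b, hab⟩ := hex
    refine hst _ (direction_ne_zero hab.ne) (lf (-(b 1 - a 1), b 0 - a 0) a) _ fun z hz => ?_
    obtain ⟨hzP, a', b', hab', hm⟩ := Finset.mem_filter.1 hz
    exact ⟨hzP, (lineMeets_iff_stabs a b _).1 (hab.lineMeets_of hs hab' hm)⟩
  · have : P.filter (fun z => MeetsTangent P l x y z s) = ∅ :=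
      Finset.filter_eq_empty_iff.2 fun z _ ⟨a, b, hab, _⟩ => hex ⟨a, b, hab⟩
    rw [this, Finset.card_empty, Nat.cast_zero]
    simpa using hst (1, 0) (by simp) 0 ∅ (by simp)

theorem exists_meetsTangent_of_orientationSign_ne {P : Finset Plane} {ι : Type*} [DecidableEq ι]
    {l : Plane → ι}
    (hsep : ∀ i j, i ≠ j → Separated (P.filter (l · = i)) (P.filter (l · = j)))
    {pt f g : Fin 3 → Plane} (hpt : ∀ i j, i ≠ j → l (pt i) ≠ l (pt j))
    (hf : ∀ i, f i ∈ P ∧ l (f i) = l (pt i)) (hg : ∀ i, g i ∈ P ∧ l (g i) = l (pt i))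
    (hne : orientationSign (f 0) (f 1) (f 2) ≠ orientationSign (g 0) (g 1) (g 2)) :
    ∃ i j k, i ≠ j ∧ i ≠ k ∧ j ≠ k ∧ (MeetsTangent P l (pt i) (pt j) (pt k) 1 ∨
      MeetsTangent P l (pt i) (pt j) (pt k) (-1)) := by
  obtain ⟨i, j, k, hij, hik, hjk, s, hs, a, b, hab, hm⟩ :=
    exists_innerTangent_of_orientationSign_ne (A := fun i => P.filter (l · = l (pt i)))
      (fun i j hij => hsep _ _ (hpt i j hij)) (fun i => Finset.mem_filter.2 (hf i))
      (fun i => Finset.mem_filter.2 (hg i)) hne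
  refine ⟨i, j, k, hij, hik, hjk, ?_⟩
  rcases hs with rfl | rfl
  · exact Or.inl ⟨a, b, hab, hm⟩
  · exact Or.inr ⟨a, b, hab, hm⟩

/-- The point `z` is exceptional for the pair `x`, `y`: it lies in `N`, or in the class of `x`, or
its class meets an inner tangent of the classes of `x` and `y`. -/
def Exceptional {ι : Type*} [DecidableEq ι] (P : Finset Plane) (l : Plane → ι) (N : Finset Plane)
    (x y z : Plane) : Prop :=
  z ∈ N ∨ l z = l x ∨ MeetsTangent P l x y z 1 ∨ MeetsTangent P l x y z (-1)

theorem card_exceptional_le {P : Finset Plane} {ι : Type*} [DecidableEq ι] {l : Plane → ι} {D : ℝ}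
    (hst : ∀ u : ℝ × ℝ, u ≠ 0 → ∀ c (S : Finset Plane),
      (∀ p ∈ S, p ∈ P ∧ Stabs u c (P.filter (l · = l p))) → (S.card : ℝ) ≤ D)
    (N : Finset Plane) (x y : Plane) :
    ((P.filter (Exceptional P l N x y)).card : ℝ) ≤ N.card + 3 * D := by
  have h1 : (P.filter (Exceptional P l N x y)).card ≤ N.card + ((P.filter (l · = l x)).card +
      ((P.filter fun z => MeetsTangent P l x y z 1).card +
        (P.filter fun z => MeetsTangent P l x y z (-1)).card)) := by
    have : P.filter (Exceptional P l N x y) ⊆ N ∪ (P.filter (l · = l x) ∪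
        (P.filter (fun z => MeetsTangent P l x y z 1) ∪
          P.filter fun z => MeetsTangent P l x y z (-1))) := by
      intro z hz
      simp only [Finset.mem_filter, Finset.mem_union, Exceptional] at hz ⊢
      tauto
    refine (Finset.card_le_card this).trans ((Finset.card_union_le _ _).trans ?_)
    refine Nat.add_le_add_left ((Finset.card_union_le _ _).trans ?_) _
    exact Nat.add_le_add_left (Finset.card_union_le _ _) _
  have h2 := card_labelled_le hst (l x)
  have h3 := card_meetsTangent_le hst x y (Or.inl rfl)
  have h4 := card_meetsTangent_le hst x y (Or.inr rfl)
  have h5 : ((P.filter (Exceptional P l N x y)).card : ℝ) ≤ _ := Nat.cast_le.2 h1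
  push_cast at h5
  linarith

/-- If none of the points is in `N` and their classes differ, each part lies inside the class of its
point, so the bad triple of parts yields a bad triple of separated classes and hence a tangent. The
six orders reflect that the tangent pair is not known in advance. -/
theorem exceptional_of_mem_badTriples {P : Finset Plane} {ι : Type*} [DecidableEq ι]
    {l : Plane → ι}
    (hsep : ∀ i j, i ≠ j → Separated (P.filter (l · = i)) (P.filter (l · = j)))
    {K : ℕ} {A : Fin K → Finset Plane} (hAP : ∀ i, A i ⊆ P) {N : Finset Plane}
    (hN : ∀ i, ∀ p ∈ A i, p ∉ N → ∀ q ∈ A i, l q = l p) {t : Fin K × Fin K × Fin K}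
    (ht : t ∈ badTriples A) {x y z : Plane} (hx : x ∈ A t.1) (hy : y ∈ A t.2.1)
    (hz : z ∈ A t.2.2) :
    Exceptional P l N x y z ∨ Exceptional P l N x z y ∨ Exceptional P l N y x z ∨
      Exceptional P l N y z x ∨ Exceptional P l N z x y ∨ Exceptional P l N z y x := by
  by_cases hxN : x ∈ N
  · exact Or.inr (Or.inr (Or.inr (Or.inl (Or.inl hxN))))
  by_cases hyN : y ∈ N
  · exact Or.inr (Or.inl (Or.inl hyN))
  by_cases hzN : z ∈ N
  · exact Or.inl (Or.inl hzN)
  by_cases hzx : l z = l x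
  · exact Or.inl (Or.inr (Or.inl hzx))
  by_cases hyx : l y = l x
  · exact Or.inr (Or.inl (Or.inr (Or.inl hyx)))
  by_cases hzy : l z = l y
  · exact Or.inr (Or.inr (Or.inl (Or.inr (Or.inl hzy))))
  obtain ⟨-, -, f, g, hf, hg, hne⟩ := (Finset.mem_filter.1 ht).2
  have hsub : ∀ i q, q ∈ A (![t.1, t.2.1, t.2.2] i) → q ∈ P ∧ l q = l (![x, y, z] i) := by
    intro i q hq
    refine ⟨hAP _ hq, ?_⟩
    fin_cases i
    · exact hN _ x hx hxN q hq
    · exact hN _ y hy hyN q hq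
    · exact hN _ z hz hzN q hq
  have hpt : ∀ i j, i ≠ j → l (![x, y, z] i) ≠ l (![x, y, z] j) := by
    intro i j hij
    fin_cases i <;> fin_cases j
    · exact absurd rfl hij
    · exact Ne.symm hyx
    · exact Ne.symm hzx
    · exact hyx
    · exact absurd rfl hij
    · exact Ne.symm hzy
    · exact hzx
    · exact hzy
    · exact absurd rfl hij
  obtain ⟨i, j, k, hij, hik, hjk, hR⟩ := exists_meetsTangent_of_orientationSign_ne hsep hpt
    (fun i => hsub i _ (hf i)) (fun i => hsub i _ (hg i)) hne
  have hR' : Exceptional P l N (![x, y, z] i) (![x, y, z] j) (![x, y, z] k) := Or.inr (Or.inr hR)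
  have hperm : ∀ i j k : Fin 3, i ≠ j → i ≠ k → j ≠ k →
      (i, j, k) = (0, 1, 2) ∨ (i, j, k) = (0, 2, 1) ∨ (i, j, k) = (1, 0, 2) ∨
        (i, j, k) = (1, 2, 0) ∨ (i, j, k) = (2, 0, 1) ∨ (i, j, k) = (2, 1, 0) := by decide
  have h6 := hperm i j k hij hik hjk
  simp only [Prod.mk.injEq] at h6
  rcases h6 with ⟨rfl, rfl, rfl⟩ | ⟨rfl, rfl, rfl⟩ | ⟨rfl, rfl, rfl⟩ | ⟨rfl, rfl, rfl⟩ |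
    ⟨rfl, rfl, rfl⟩ | ⟨rfl, rfl, rfl⟩
  · exact Or.inl hR'
  · exact Or.inr (Or.inl hR')
  · exact Or.inr (Or.inr (Or.inl hR'))
  · exact Or.inr (Or.inr (Or.inr (Or.inl hR')))
  · exact Or.inr (Or.inr (Or.inr (Or.inr (Or.inl hR'))))
  · exact Or.inr (Or.inr (Or.inr (Or.inr (Or.inr hR'))))

theorem card_le_of_symmetrized {P : Finset Plane} {W : Finset (Plane × Plane × Plane)}
    (hWP : W ⊆ P ×ˢ P ×ˢ P) {R : Plane → Plane → Plane → Prop} {D : ℝ}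
    (hR : ∀ x ∈ P, ∀ y ∈ P, ((P.filter (R x y)).card : ℝ) ≤ D)
    (hW : ∀ x y z, (x, y, z) ∈ W →
      R x y z ∨ R x z y ∨ R y x z ∨ R y z x ∨ R z x y ∨ R z y x) :
    (W.card : ℝ) ≤ 6 * (P.card : ℝ) ^ 2 * D := by
  obtain ⟨r, hr⟩ : ∃ r : Plane → Plane → Plane → ℝ, ∀ x y z, r x y z = if R x y z then 1 else 0 :=
    ⟨_, fun _ _ _ => rfl⟩
  have hr0 : ∀ x y z, 0 ≤ r x y z := fun x y z => by rw [hr]; split_ifs <;> norm_num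
  have hr1 : ∀ x y z, R x y z → r x y z = 1 := fun x y z h => by rw [hr, if_pos h]
  have hrD : ∀ x ∈ P, ∀ y ∈ P, ∑ z ∈ P, r x y z ≤ D := by
    intro x hx y hy
    simp only [hr, Finset.sum_boole]
    exact hR x hx y hy
  refine le_trans ?_ (sum_symmetrized_le P r hrD)
  obtain ⟨χ, hχ1, hχ0⟩ : ∃ χ : Plane × Plane × Plane → ℝ, (∀ w ∈ W, χ w = 1) ∧
      ∀ w, w ∉ W → χ w = 0 :=
    ⟨fun w => if w ∈ W then 1 else 0, fun w hw => if_pos hw, fun w hw => if_neg hw⟩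
  calc (W.card : ℝ) = ∑ w ∈ P ×ˢ P ×ˢ P, χ w := by
        rw [← Finset.sum_subset hWP fun w _ => hχ0 w, Finset.sum_congr rfl hχ1]
        simp
    _ = ∑ x ∈ P, ∑ y ∈ P, ∑ z ∈ P, χ (x, y, z) := by
        rw [Finset.sum_product]
        exact Finset.sum_congr rfl fun x _ => Finset.sum_product _ _ _
    _ ≤ _ := by
        refine Finset.sum_le_sum fun x _ => Finset.sum_le_sum fun y _ =>
          Finset.sum_le_sum fun z _ => ?_
        have g1 := hr0 x y z
        have g2 := hr0 x z y
        have g3 := hr0 y x z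
        have g4 := hr0 y z x
        have g5 := hr0 z x y
        have g6 := hr0 z y x
        by_cases h : (x, y, z) ∈ W
        · rw [hχ1 _ h]
          rcases hW x y z h with h | h | h | h | h | h <;> linarith [hr1 _ _ _ h]
        · rw [hχ0 _ h]
          linarith

/-- Counting triples of parts of a refinement with transversals of different orientations. -/
theorem card_badTriples_mul_le {P : Finset Plane} {ι : Type*} [DecidableEq ι] {l : Plane → ι} {D : ℝ}
    (hsep : ∀ i j, i ≠ j → Separated (P.filter (l · = i)) (P.filter (l · = j)))
    (hst : ∀ u : ℝ × ℝ, u ≠ 0 → ∀ c (S : Finset Plane),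
      (∀ p ∈ S, p ∈ P ∧ Stabs u c (P.filter (l · = l p))) → (S.card : ℝ) ≤ D)
    {K m : ℕ} {A : Fin K → Finset Plane} (hA : IsEquitablePartition P A)
    (hm : ∀ i, m ≤ (A i).card) {N : Finset Plane}
    (hN : ∀ i, ∀ p ∈ A i, p ∉ N → ∀ q ∈ A i, l q = l p) :
    ((badTriples A).card : ℝ) * (m : ℝ) ^ 3 ≤ 6 * (P.card : ℝ) ^ 2 * (N.card + 3 * D) := by
  have hAP : ∀ i, A i ⊆ P := fun i p hp => (hA.mem_iff p).2 ⟨i, hp⟩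
  let W : Finset (Plane × Plane × Plane) :=
    (badTriples A).biUnion fun t => A t.1 ×ˢ A t.2.1 ×ˢ A t.2.2
  have hWP : W ⊆ P ×ˢ P ×ˢ P := by
    intro w hw
    obtain ⟨t, -, ht⟩ := Finset.mem_biUnion.1 hw
    simp only [Finset.mem_product] at ht ⊢
    exact ⟨hAP _ ht.1, hAP _ ht.2.1, hAP _ ht.2.2⟩
  have hWcard : (badTriples A).card * m ^ 3 ≤ W.card := by
    rw [Finset.card_biUnion]
    · rw [← smul_eq_mul, ← Finset.sum_const]
      refine Finset.sum_le_sum fun t _ => ?_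
      rw [Finset.card_product, Finset.card_product]
      calc m ^ 3 = m * (m * m) := by ring
        _ ≤ _ := Nat.mul_le_mul (hm _) (Nat.mul_le_mul (hm _) (hm _))
    · intro t _ t' _ htt'
      refine Finset.disjoint_left.2 fun w hw hw' => htt' ?_
      simp only [Finset.mem_product] at hw hw'
      have aux : ∀ {i j : Fin K} {p : Plane}, p ∈ A i → p ∈ A j → i = j := by
        intro i j p hi hj
        by_contra hij
        exact Finset.disjoint_left.1 (hA.disjoint i j hij) hi hj
      exact Prod.ext (aux hw.1 hw'.1) (Prod.ext (aux hw.2.1 hw'.2.1) (aux hw.2.2 hw'.2.2))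
  have hfin := card_le_of_symmetrized hWP (fun x _ y _ => card_exceptional_le hst N x y)
    fun x y z hw => by
      obtain ⟨t, ht, hxyz⟩ := Finset.mem_biUnion.1 hw
      simp only [Finset.mem_product] at hxyz
      exact exceptional_of_mem_badTriples hsep hAP hN ht hxyz.1 hxyz.2.1 hxyz.2.2
  have hcast : ((badTriples A).card : ℝ) * (m : ℝ) ^ 3 ≤ W.card := by exact_mod_cast hWcard
  exact hcast.trans hfin

end

/-! ### Parameters of the same-type partition -/

theorem pow_four_le_choose {K : ℕ} (hK : 6 ≤ K) : (K : ℝ) ^ 4 ≤ 192 * (K.choose 4 : ℝ) := by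
  have h1 := Nat.descFactorial_eq_factorial_mul_choose K 4
  have h2 : K.descFactorial 4 = (K - 3) * ((K - 2) * ((K - 1) * K)) := by
    simp [Nat.descFactorial]
  have h3 : Nat.factorial 4 = 24 := rfl
  rw [h2, h3] at h1
  obtain ⟨j, rfl⟩ := Nat.exists_eq_add_of_le hK
  have h4 : ((6 + j - 3 : ℕ) : ℝ) = j + 3 := by
    rw [show 6 + j - 3 = j + 3 by omega]; push_cast; ring
  have h5 : ((6 + j - 2 : ℕ) : ℝ) = j + 4 := by
    rw [show 6 + j - 2 = j + 4 by omega]; push_cast; ring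
  have h6 : ((6 + j - 1 : ℕ) : ℝ) = j + 5 := by
    rw [show 6 + j - 1 = j + 5 by omega]; push_cast; ring
  have h7 : ((j : ℝ) + 3) * ((j + 4) * ((j + 5) * (6 + j))) = 24 * ((6 + j).choose 4 : ℝ) := by
    rw [← h4, ← h5, ← h6]
    exact_mod_cast h1
  have hj : (0 : ℝ) ≤ j := Nat.cast_nonneg j
  push_cast
  have : 192 * ((6 + j).choose 4 : ℝ) = 8 * (((j : ℝ) + 3) * ((j + 4) * ((j + 5) * (6 + j)))) := by
    rw [h7]; ring
  -- The factor 8 suffices because K - 3 ≥ K/2 when K ≥ 6.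
  rw [this, ← sub_nonneg]
  ring_nf
  positivity

/-- Large point sets have equitable partitions with few quadruples of parts that do not have
same-type transversals. -/
theorem exists_sameTypePartition_of_card_ge {P : Finset Plane} (hP : InGeneralPosition P) {K k : ℕ}
    {η : ℝ} (hKP : K ≤ P.card) (hK : 6 ≤ K) (hk : (3 / 4 : ℝ) ^ k ≤ η)
    (hkK : 16 * 4 ^ k ≤ η * K) : ∃ A : Fin K → Finset Plane, IsEquitablePartition P A ∧
      ((badQuadruples A).card : ℝ) ≤ 2 ^ 16 * η * (K.choose 4 : ℝ) := by
  classical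
  obtain ⟨l, hsep, hst⟩ := exists_labelling_stabs_le k P hP
  obtain ⟨A, hA, hm, N, hN, hNl⟩ := exists_equitable_refinement P l (by omega : 0 < K) hKP
  refine ⟨A, hA, ?_⟩
  have hη : 0 ≤ η := le_trans (by positivity) hk
  obtain ⟨n, hn⟩ : ∃ n : ℝ, n = (P.card : ℝ) := ⟨_, rfl⟩
  have hK0 : (0 : ℝ) < K := by exact_mod_cast (by omega : 0 < K)
  have hKn : (K : ℝ) ≤ n := by rw [hn]; exact_mod_cast hKP
  have hn0 : 0 < n := hK0.trans_le hKn
  obtain ⟨m, hmd⟩ : ∃ m, m = P.card / K := ⟨_, rfl⟩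
  rw [← hmd] at hN hm
  have hm1 : 1 ≤ m := hmd ▸ Nat.div_pos hKP (by omega)
  have hmn : (m : ℝ) * K ≤ n := by
    rw [hn, hmd]; exact_mod_cast Nat.div_mul_le_self _ _
  have hm2 : n ≤ 2 * m * K := by
    have h1 : P.card < (m + 1) * K := by
      rw [hmd, mul_comm]; exact Nat.lt_mul_div_succ _ (by omega)
    have h2 : P.card ≤ 2 * m * K := h1.le.trans (Nat.mul_le_mul_right _ (by omega))
    rw [hn]; exact_mod_cast h2
  have key := card_badTriples_mul_le hsep hst hA hm hNl
  rw [← hn] at key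
  have hNn : (N.card : ℝ) ≤ η * n := by
    have h1 : (N.card : ℝ) ≤ 4 ^ k * m := by
      have := hN
      simp only [Fintype.card_fun, Fintype.card_prod, Fintype.card_bool, Fintype.card_fin] at this
      exact_mod_cast this
    have h2 : (4 : ℝ) ^ k ≤ η * K := by
      have : (0 : ℝ) ≤ 4 ^ k := by positivity
      linarith
    calc (N.card : ℝ) ≤ 4 ^ k * m := h1
      _ ≤ η * K * m := by gcongr
      _ = η * (m * K) := by ring
      _ ≤ η * n := by gcongr
  have hD : (3 / 4 : ℝ) ^ k * n + 16 * 4 ^ k ≤ 2 * η * n := by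
    have h1 : (3 / 4 : ℝ) ^ k * n ≤ η * n := by gcongr
    have h2 : η * K ≤ η * n := by gcongr
    linarith
  -- Here 336 = 6 · (1 + 3·2) · 8, where the 8 comes from n ≤ 2mK.
  have hT : ((badTriples A).card : ℝ) ≤ 336 * η * K ^ 3 := by
    have h1 : ((badTriples A).card : ℝ) * n ^ 3 ≤ 336 * η * K ^ 3 * n ^ 3 := by
      calc ((badTriples A).card : ℝ) * n ^ 3
          ≤ (badTriples A).card * (2 * m * K) ^ 3 := by gcongr
        _ = (badTriples A).card * (m : ℝ) ^ 3 * (8 * K ^ 3) := by ring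
        _ ≤ 6 * n ^ 2 * (N.card + 3 * ((3 / 4) ^ k * n + 16 * 4 ^ k)) * (8 * K ^ 3) := by gcongr
        _ ≤ 6 * n ^ 2 * (η * n + 3 * (2 * η * n)) * (8 * K ^ 3) := by gcongr
        _ = _ := by ring
    exact le_of_mul_le_mul_right h1 (by positivity)
  calc ((badQuadruples A).card : ℝ) ≤ (badTriples A).card * K := by
        exact_mod_cast card_badQuadruples_le A
    _ ≤ 336 * η * K ^ 3 * K := by gcongr
    _ = 336 * η * K ^ 4 := by ring
    _ ≤ 336 * η * (192 * (K.choose 4 : ℝ)) := by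
        gcongr
        exact pow_four_le_choose hK
    -- 336 · 192 = 64512 < 2^16.
    _ ≤ 2 ^ 16 * η * (K.choose 4 : ℝ) := by
        have : 0 ≤ η * (K.choose 4 : ℝ) := by positivity
        linarith

/-- Point sets with fewer points than parts are partitioned into singletons and empty sets. -/
theorem exists_sameTypePartition_of_card_lt {P : Finset Plane} {K : ℕ} (h : P.card < K) :
    ∃ A : Fin K → Finset Plane, IsEquitablePartition P A ∧ (badQuadruples A).card = 0 := by
  classical
  let A : Fin K → Finset Plane := fun i => P.filter fun p => ∃ hp : p ∈ P,
    (P.equivFin ⟨p, hp⟩ : ℕ) = i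
  have hA : ∀ i p q, p ∈ A i → q ∈ A i → p = q := by
    intro i p q hp hq
    obtain ⟨-, hp, hpi⟩ := Finset.mem_filter.1 hp
    obtain ⟨-, hq, hqi⟩ := Finset.mem_filter.1 hq
    have := P.equivFin.injective (Fin.ext (hpi.trans hqi.symm))
    exact congrArg Subtype.val this
  refine ⟨A, ⟨fun i j hij => ?_, fun p => ?_, fun i j => ?_⟩, ?_⟩
  · refine Finset.disjoint_left.2 fun p hp hq => hij ?_
    obtain ⟨-, hp, hpi⟩ := Finset.mem_filter.1 hp
    obtain ⟨-, hq, hqi⟩ := Finset.mem_filter.1 hq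
    exact Fin.ext (hpi.symm.trans hqi)
  · constructor
    · intro hp
      exact ⟨⟨P.equivFin ⟨p, hp⟩, (P.equivFin ⟨p, hp⟩).2.trans h⟩,
        Finset.mem_filter.2 ⟨hp, hp, rfl⟩⟩
    · rintro ⟨i, hi⟩
      exact (Finset.mem_filter.1 hi).1
  · have : (A i).card ≤ 1 := Finset.card_le_one.2 fun p hp q hq => hA i p q hp hq
    omega
  · rw [Finset.card_eq_zero, badQuadruples, Finset.filter_eq_empty_iff]
    intro s _ hs
    refine hs fun f g hf hg i hi j hj k hk _ _ => ?_
    rw [hA i _ _ (hf i hi) (hg i hi), hA j _ _ (hf j hj) (hg j hj), hA k _ _ (hf k hk) (hg k hk)]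

theorem isSameTypePartitionConstant_131 : IsSameTypePartitionConstant 131 := by
  intro ε hε hε2 P hP
  obtain ⟨j, hj1, hj2⟩ := exists_nat_pow_near (x := 1 / ε) (y := 2)
    (by rw [le_div_iff₀ hε]; linarith) (by norm_num)
  have hj0 : 1 ≤ j := by
    by_contra hj
    obtain rfl : j = 0 := by omega
    rw [div_lt_iff₀ hε, zero_add, pow_one] at hj2
    linarith
  have hεj : 1 / 2 ^ (j + 1) ≤ ε := by
    rw [div_le_iff₀ (by positivity)]
    rw [div_lt_iff₀ hε] at hj2
    linarith
  have hη : 1 / 2 ^ (j + 17) ≤ ε / 2 ^ 16 := by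
    calc (1 : ℝ) / 2 ^ (j + 17) = 1 / 2 ^ (j + 1) / 2 ^ 16 := by
          rw [div_div, ← pow_add]
      _ ≤ _ := by gcongr
  -- With η = 2^(-(j+17)) ≤ ε/2^16 and k = 3(j+17), one has (3/4)^k ≤ η because (3/4)³ < 1/2, and
  -- this K is exactly 16·4^k/η.
  obtain ⟨K, hKd⟩ : ∃ K : ℕ, K = 2 ^ (4 + 7 * (j + 17)) := ⟨_, rfl⟩
  have hK6 : 6 ≤ K := by
    rw [hKd]
    calc 6 ≤ 2 ^ 3 := by norm_num
      _ ≤ _ := Nat.pow_le_pow_right (by norm_num) (by omega)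
  have hKlow : 1 / ε < K := by
    refine hj2.trans_le ?_
    rw [hKd]
    push_cast
    exact pow_le_pow_right₀ (by norm_num) (by omega)
  have hKhigh : (K : ℝ) < ε ^ (-(131 : ℝ)) := by
    have h1 : ε ^ (-(131 : ℝ)) = (1 / ε) ^ 131 := by
      rw [Real.rpow_neg hε.le, ← Real.rpow_natCast, one_div, Real.inv_rpow hε.le]
      norm_num
    rw [h1, hKd]
    push_cast
    -- The exponent 7j + 123 is below 131j as soon as j ≥ 1, which is where 131 comes from.
    calc (2 : ℝ) ^ (4 + 7 * (j + 17)) < 2 ^ (j * 131) :=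
          pow_lt_pow_right₀ (by norm_num) (by omega)
      _ = (2 ^ j) ^ 131 := pow_mul _ _ _
      _ ≤ _ := by gcongr
  have hbound : ∃ A : Fin K → Finset Plane, IsEquitablePartition P A ∧
      ((badQuadruples A).card : ℝ) ≤ ε * (K.choose 4 : ℝ) := by
    by_cases hPK : K ≤ P.card
    · have hk : (3 / 4 : ℝ) ^ (3 * (j + 17)) ≤ ε / 2 ^ 16 := by
        refine le_trans ?_ hη
        rw [pow_mul, ← one_div_pow]
        exact pow_le_pow_left₀ (by norm_num) (by norm_num) _
      have hkK : 16 * 4 ^ (3 * (j + 17)) ≤ ε / 2 ^ 16 * K := by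
        calc (16 : ℝ) * 4 ^ (3 * (j + 17)) = 1 / 2 ^ (j + 17) * 2 ^ (4 + 7 * (j + 17)) := by
              rw [show (4 : ℝ) = 2 ^ 2 by norm_num, show (16 : ℝ) = 2 ^ 4 by norm_num, ← pow_mul,
                ← pow_add, one_div, eq_inv_mul_iff_mul_eq₀ (by positivity), ← pow_add]
              congr 1
              ring
          _ ≤ ε / 2 ^ 16 * 2 ^ (4 + 7 * (j + 17)) := by gcongr
          _ = _ := by rw [hKd]; push_cast; ring
      obtain ⟨A, hA, hb⟩ := exists_sameTypePartition_of_card_ge hP hPK hK6 hk hkK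
      exact ⟨A, hA, hb.trans (le_of_eq (by ring))⟩
    · obtain ⟨A, hA, hb⟩ := exists_sameTypePartition_of_card_lt (not_le.1 hPK)
      refine ⟨A, hA, ?_⟩
      rw [hb, Nat.cast_zero]
      exact mul_nonneg hε.le (Nat.cast_nonneg _)
  obtain ⟨A, hA, hb⟩ := hbound
  exact ⟨K, A, hKlow, hKhigh, hA, hb⟩

theorem lemma3p2 :
    (∃ C : ℝ, IsSameTypePartitionConstant C) ∧
    ∀ C : ℝ, IsSameTypePartitionConstant C →
      ∀ ε : ℝ, 0 < ε → ε < 1 / 2 →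
        ∀ (V : Type*) [Fintype V] (G G' : EdgeWeightedGraph V),
          G.cutDistance G' < ε * (Fintype.card V : ℝ) ^ 2 →
            |G.rectilinearCrossingNumber - G'.rectilinearCrossingNumber|
              ≤ ε ^ (1 / (4 * C)) * (Fintype.card V : ℝ) ^ 4 :=
  ⟨⟨131, isSameTypePartitionConstant_131⟩, fun _ hC _ hε _ _ _ G G' hd =>
    hC.abs_rectilinearCrossingNumber_sub_le hε G G' hd⟩
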